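/- Let $R$ be a commutative ring, $n\ge 1$, and $A=R[\mathbb{Z}/n\mathbb{Z}]=R[\sigma]/(\sigma^n-1)$. Let $HH^k(A;A)$ be the cohomology of the Hochschild cochain complex $C^k=\mathrm{Hom}_R(A^{\otimes k},A)$ (equivalently $\mathrm{Ext}^k_{A\otimes A^{op}}(A,A)$, as $A$ is $R$-free), and let $HH^*(A;A)=\bigoplus_k HH^k(A;A)$ carry the cup product induced by $(f\smile g)(a_1,\dots,a_{k+l})=f(a_1,\dots,a_k)\,g(a_{k+1},\dots,a_{k+l})$. For $a\in A$ and $0\le i_1,i_2,\dots<n$ define cochains by multilinear extension of $$f_{2r}(a)(\sigma^{i_1},\dots,\sigma^{i_{2r}})=(-1)^r\,a\,\sigma^{i_1+\cdots+i_{2r}-rn}\ \text{ if } i_{2k-1}+i_{2k}\ge n \text{ for } 1\le k\le r,\ \text{ and } 0 \text{ otherwise},$$ $$f_{2r+1}(a)(\sigma^{i_1},\dots,\sigma^{i_{2r+1}})=(-1)^{r+1}\,i_1\,a\,\sigma^{i_1+\cdots+i_{2r+1}-rn-1}\ \text{ if } i_{2k}+i_{2k+1}\ge n \text{ for } 1\le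 k\le r,\ \text{ and } 0 \text{ otherwise}.$$ 1. For every $r\ge 0$, $f_{2r}(a)$ is a cocycle for each $a\in A$ and $f_{2r+1}(a)$ is a cocycle for each $a\in \mathrm{Ann}(n\sigma^{n-1})$. Sending $a$ to the class $[a]$ of the corresponding cocycle induces $R$-linear isomorphisms $A\cong HH^0(A;A)$, $A/(n\sigma^{n-1})\cong HH^{2r}(A;A)$ for $r\ge1$, and $\mathrm{Ann}(n\sigma^{n-1})\cong HH^{2r+1}(A;A)$ for $r\ge 0$. 2. Under these identifications the cup product $[a]\smile[b]$ of classes of degrees $i$ and $j$ is the class $[ab]$ if $i$ or $j$ is even, and $$[a]\smile[b]=\Big[-\tfrac{n(n-1)}{2}\,ab\,\sigma^{n-2}\Big]$$ if $i$ and $j$ are both odd (for $n=1$ the right-hand side is $0$). 3. There is an isomorphism of $R$-algebras $HH^{2*}(A;A)=\bigoplus_r HH^{2r}(A;A)\cong R[x,z]/(x^n-1,\,nz)$, under which $x$ corresponds to $[\sigma]\in HH^0(A;A)$ and $z$ to $[1]\in HH^2(A;A)$. 4. Suppose in addition that $R$ has characteristic $p>0$ and $n=mp$. - If $p$ is odd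 or $m$ is even (for $p$ prime: if $p\ne2$, or $p=2$ and $m$ is even), then $HH^*(A;A)\cong R[x,y,z]/(x^n-1,\,y^2)$ as $R$-algebras. - If $p=2$ and $m$ is odd, then $HH^*(A;A)\cong R[x,y,z]/(x^n-1,\,y^2-x^{n-2}z)$ as $R$-algebras. In both cases $x,y,z$ correspond to $[\sigma]\in HH^0(A;A)$, $[1]\in HH^1(A;A)$ and $[1]\in HH^2(A;A)$, respectively. -/

import Mathlib

noncomputable section

namespace Hochschild

/-- The module of Hochschild `k`-cochains of the `R`-algebra `A` with coefficients in `A`: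
`Hom_R(A^{⊗k}, A)`, that is, the `R`-multilinear maps from `A^k` to `A`. -/
def Cochain (R A : Type*) [CommRing R] [Ring A] [Algebra R A] (k : ℕ) : Type _ :=
  MultilinearMap R (fun _ : Fin k => A) A

section
variable {R A : Type*} [CommRing R] [Ring A] [Algebra R A]

instance (k : ℕ) : AddCommGroup (Cochain R A k) :=
  inferInstanceAs (AddCommGroup (MultilinearMap R (fun _ : Fin k => A) A))

instance (k : ℕ) : Module R (Cochain R A k) :=
  inferInstanceAs (Module R (MultilinearMap R (fun _ : Fin k => A) A))

instance (k : ℕ) : FunLike (Cochain R A k) (Fin k → A) A :=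
  inferInstanceAs (FunLike (MultilinearMap R (fun _ : Fin k => A) A) (Fin k → A) A)

variable (R A) in
/-- A multilinear map, regarded as a Hochschild cochain (the identity map). -/
def Cochain.of (k : ℕ) : MultilinearMap R (fun _ : Fin k => A) A ≃ₗ[R] Cochain R A k :=
  LinearEquiv.refl R (MultilinearMap R (fun _ : Fin k => A) A)

@[simp] theorem Cochain.of_apply {k : ℕ} (f : MultilinearMap R (fun _ : Fin k => A) A)
    (a : Fin k → A) : Cochain.of R A k f a = f a := rfl

@[simp] theorem Cochain.of_symm_apply {k : ℕ} (f : Cochain R A k)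
    (a : Fin k → A) : (Cochain.of R A k).symm f a = f a := rfl

@[ext] theorem Cochain.ext {k : ℕ} {f g : Cochain R A k} (h : ∀ a, f a = g a) : f = g :=
  DFunLike.ext f g h

@[simp] theorem Cochain.add_apply {k : ℕ} (f g : Cochain R A k) (a : Fin k → A) :
    (f + g) a = f a + g a := rfl

@[simp] theorem Cochain.zero_apply {k : ℕ} (a : Fin k → A) : (0 : Cochain R A k) a = 0 := rfl

@[simp] theorem Cochain.smul_apply {k : ℕ} (r : R) (f : Cochain R A k) (a : Fin k → A) :
    (r • f) a = r • f a := rfl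

@[simp] theorem Cochain.sum_apply {ι : Type*} {k : ℕ} (s : Finset ι) (f : ι → Cochain R A k)
    (a : Fin k → A) : (∑ i ∈ s, f i) a = ∑ i ∈ s, f i a :=
  _root_.sum_apply (F := MultilinearMap R (fun _ : Fin k => A) A) s f a

variable (R) in
theorem contractNth_update {k : ℕ} (j : Fin k) (a : Fin (k + 1) → A) (i : Fin (k + 1)) :
    ∃ (i' : Fin k) (L : A →ₗ[R] A),
      ∀ v : A, Fin.contractNth j.castSucc (· * ·) (Function.update a i v) =
        Function.update (Fin.contractNth j.castSucc (· * ·) a) i' (L v) := by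
  rcases lt_trichotomy (i : ℕ) (j : ℕ) with h | h | h
  · refine ⟨⟨i, by omega⟩, LinearMap.id, fun v => ?_⟩
    ext t
    rcases lt_trichotomy (t : ℕ) (i : ℕ) with h' | h' | h' <;>
      simp [Fin.contractNth, Function.update_apply, Fin.ext_iff] <;> grind
  · refine ⟨⟨i, by omega⟩, LinearMap.mulRight R (a j.succ), fun v => ?_⟩
    ext t
    rcases lt_trichotomy (t : ℕ) (i : ℕ) with h' | h' | h' <;>
      simp [Fin.contractNth, Function.update_apply, Fin.ext_iff] <;> grind
  · by_cases hj : (i : ℕ) = j + 1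
    · refine ⟨j, LinearMap.mulLeft R (a j.castSucc), fun v => ?_⟩
      ext t
      rcases lt_trichotomy (t : ℕ) (j : ℕ) with h' | h' | h' <;>
        simp [Fin.contractNth, Function.update_apply, Fin.ext_iff] <;> grind
    · refine ⟨⟨i - 1, by omega⟩, LinearMap.id, fun v => ?_⟩
      ext t
      rcases lt_trichotomy (t : ℕ) (i - 1 : ℕ) with h' | h' | h' <;>
        simp [Fin.contractNth, Function.update_apply, Fin.ext_iff] <;> grind


/-- The cochain `(a₀, …, a_k) ↦ f (a₀, …, a_j * a_{j+1}, …, a_k)`. -/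
def face {k : ℕ} (j : Fin k) (f : Cochain R A k) : Cochain R A (k + 1) :=
  Cochain.of R A (k + 1)
    { toFun := fun a => (Cochain.of R A k).symm f (Fin.contractNth j.castSucc (· * ·) a)
      map_update_add' := by
        intro inst a i x y
        rw [Subsingleton.elim inst (instDecidableEqFin _)]
        obtain ⟨i', L, h⟩ := contractNth_update R j a i
        simp only [h, MultilinearMap.map_update_add, map_add]
      map_update_smul' := by
        intro inst a i r x
        rw [Subsingleton.elim inst (instDecidableEqFin _)]
        obtain ⟨i', L, h⟩ := contractNth_update R j a i
        simp only [h, MultilinearMap.map_update_smul, map_smul] }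

/-- The cochain `(a₀, …, a_k) ↦ a₀ * f (a₁, …, a_k)`. -/
def leftFace {k : ℕ} (f : Cochain R A k) : Cochain R A (k + 1) :=
  Cochain.of R A (k + 1) <| LinearMap.uncurryLeft
    { toFun := fun x => (LinearMap.mulLeft R x).compMultilinearMap ((Cochain.of R A k).symm f)
      map_add' := fun x y => by ext; simp [add_mul]
      map_smul' := fun r x => by ext; simp }

/-- The cochain `(a₀, …, a_k) ↦ f (a₀, …, a_{k-1}) * a_k`. -/
def rightFace {k : ℕ} (f : Cochain R A k) : Cochain R A (k + 1) :=
  Cochain.of R A (k + 1) <|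
    MultilinearMap.uncurryRight ((LinearMap.mul R A).compMultilinearMap ((Cochain.of R A k).symm f))

@[simp] theorem face_apply {k : ℕ} (j : Fin k) (f : Cochain R A k) (a : Fin (k + 1) → A) :
    face j f a = f (Fin.contractNth j.castSucc (· * ·) a) := rfl

@[simp] theorem leftFace_apply {k : ℕ} (f : Cochain R A k) (a : Fin (k + 1) → A) :
    leftFace f a = a 0 * f (fun i => a i.succ) := rfl

@[simp] theorem rightFace_apply {k : ℕ} (f : Cochain R A k) (a : Fin (k + 1) → A) :
    rightFace f a = f (fun i => a i.castSucc) * a (Fin.last k) := rfl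

variable (R A) in
/-- The Hochschild differential. -/
def d (k : ℕ) : Cochain R A k →ₗ[R] Cochain R A (k + 1) where
  toFun f := leftFace f + ∑ j : Fin k, (-1 : R) ^ ((j : ℕ) + 1) • face j f +
    (-1 : R) ^ (k + 1) • rightFace f
  map_add' f g := by
    ext a
    simp [mul_add, add_mul, Finset.sum_add_distrib]
    abel
  map_smul' r f := by
    ext a
    simp [Finset.smul_sum, smul_comm r]

/-- The formula for the Hochschild differential:
`(d f)(a₀, …, a_k) = a₀ f(a₁, …, a_k) + ∑_{j<k} (-1)^{j+1} f(a₀, …, a_j a_{j+1}, …, a_k)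
  + (-1)^{k+1} f(a₀, …, a_{k-1}) a_k`. -/
theorem d_apply {k : ℕ} (f : Cochain R A k) (a : Fin (k + 1) → A) :
    d R A k f a = a 0 * f (fun i => a i.succ) +
      ∑ j : Fin k, (-1 : R) ^ ((j : ℕ) + 1) • f (Fin.contractNth j.castSucc (· * ·) a) +
      (-1 : R) ^ (k + 1) • (f (fun i => a i.castSucc) * a (Fin.last k)) := by
  simp [d]

/-- The cup product of Hochschild cochains:
`(f ⌣ g)(a₁, …, a_{k+l}) = f(a₁, …, a_k) g(a_{k+1}, …, a_{k+l})`. -/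
def cup {k l : ℕ} (f : Cochain R A k) (g : Cochain R A l) : Cochain R A (k + l) :=
  Cochain.of R A (k + l) <|
    ((LinearMap.mul' R A).compMultilinearMap
      (((Cochain.of R A k).symm f).domCoprod ((Cochain.of R A l).symm g))).domDomCongr
        finSumFinEquiv

@[simp] theorem cup_apply {k l : ℕ} (f : Cochain R A k) (g : Cochain R A l)
    (a : Fin (k + l) → A) :
    cup f g a = f (fun i => a (Fin.castAdd l i)) * g (fun i => a (Fin.natAdd k i)) := by
  simp [cup]

theorem d_cup {k l : ℕ} (f : Cochain R A k) (g : Cochain R A l) (a : Fin (k + l + 1) → A) :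
    d R A (k + l) (cup f g) a =
      d R A k f (fun i => a ⟨i, by omega⟩) * g (fun i => a ⟨k + 1 + i, by omega⟩) +
      (-1 : R) ^ k • (f (fun i => a ⟨i, by omega⟩) *
        d R A l g (fun i => a ⟨k + i, by omega⟩)) := by
  have h1 : ∀ j : Fin k, cup f g (Fin.contractNth (Fin.castAdd l j).castSucc (· * ·) a) =
      f (Fin.contractNth j.castSucc (· * ·) (fun i => a ⟨i, by omega⟩)) *
        g (fun i => a ⟨k + 1 + i, by omega⟩) := by
    intro j
    rw [cup_apply]
    congr 2
    ext i
    rw [Fin.contractNth_apply_of_gt]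
    · congr 1; ext; simp; omega
    · simp; omega
  have h2 : ∀ j : Fin l, cup f g (Fin.contractNth (Fin.natAdd k j).castSucc (· * ·) a) =
      f (fun i => a ⟨i, by omega⟩) *
        g (Fin.contractNth j.castSucc (· * ·) (fun i => a ⟨k + i, by omega⟩)) := by
    intro j
    rw [cup_apply]
    congr 2
    · ext i
      rw [Fin.contractNth_apply_of_lt]
      · congr 1
      · simp; omega
    · ext i
      simp [Fin.contractNth]
      rfl
  rw [d_apply, d_apply, d_apply, Fin.sum_univ_add]
  simp only [h1, h2, cup_apply, add_mul, mul_add, smul_add, Finset.sum_mul, Finset.mul_sum,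
    smul_mul_assoc, mul_smul_comm, Finset.smul_sum, smul_smul, mul_assoc, ← pow_add,
    Fin.val_castAdd, Fin.val_natAdd, Fin.val_zero, Fin.val_succ, Fin.val_castSucc, Fin.val_last]
  have e1 : (fun i : Fin l => a (Fin.natAdd k i).succ) =
      fun i : Fin l => a ⟨k + 1 + i, by omega⟩ := by
    ext i; congr 1; ext; simp; omega
  have e2 : (fun i : Fin l => a ⟨k + (i + 1), by omega⟩) =
      fun i : Fin l => a ⟨k + 1 + i, by omega⟩ := by
    ext i; congr 1; ext; simp; omega
  simp only [e1, e2]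
  have e3 : (-1 : R) ^ (k + 1) = - (-1) ^ k := by ring
  have e4 : ∀ j : ℕ, (-1 : R) ^ (k + (j + 1)) = (-1) ^ (k + j + 1) := fun j => by ring
  simp only [e3, e4, neg_smul]
  have c1 : (fun i : Fin k => a (Fin.castAdd l i).succ) = fun i : Fin k => a ⟨i + 1, by omega⟩ := rfl
  have c2 : (fun i : Fin k => a (Fin.castAdd l i).castSucc) = fun i : Fin k => a ⟨i, by omega⟩ := rfl
  have c3 : (fun i : Fin l => a (Fin.natAdd k i).castSucc) = fun i : Fin l => a ⟨k + i, by omega⟩ := rfl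
  have c4 : a (Fin.last (k + l)) = a ⟨k + l, by omega⟩ := rfl
  have c5 : a 0 = a ⟨0, by omega⟩ := rfl
  simp only [c1, c2, c3, c4, c5, add_zero]
  abel

variable (R A) in
/-- Hochschild `k`-cocycles. -/
abbrev cocycles (k : ℕ) : Submodule R (Cochain R A k) := LinearMap.ker (d R A k)

variable (R A) in
/-- Hochschild `k`-coboundaries: the image of the incoming differential. -/
def coboundaries : (k : ℕ) → Submodule R (Cochain R A k)
  | 0 => ⊥
  | k + 1 => LinearMap.range (d R A k)

theorem mem_coboundaries {k m : ℕ} (h : k + 1 = m) (f : Cochain R A k) (F : Cochain R A m)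
    (hF : ∀ a, F a = d R A k f (fun i => a (Fin.cast h i))) : F ∈ coboundaries R A m := by
  subst h
  exact ⟨f, by ext a; exact (hF a).symm⟩

variable (R A) in
/-- Hochschild cohomology `HH^k(A; A)`: cocycles modulo coboundaries. -/
abbrev HH (k : ℕ) : Type _ :=
  cocycles R A k ⧸ (coboundaries R A k).comap (cocycles R A k).subtype

theorem cup_mem_cocycles {k l : ℕ} {f : Cochain R A k} {g : Cochain R A l}
    (hf : f ∈ cocycles R A k) (hg : g ∈ cocycles R A l) : cup f g ∈ cocycles R A (k + l) := by
  rw [LinearMap.mem_ker] at *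
  ext a
  rw [d_cup, hf, hg]
  simp

theorem cup_mem_coboundaries_left {k l : ℕ} {f : Cochain R A k} {g : Cochain R A l}
    (hf : f ∈ coboundaries R A k) (hg : g ∈ cocycles R A l) :
    cup f g ∈ coboundaries R A (k + l) := by
  rw [LinearMap.mem_ker] at hg
  cases k with
  | zero =>
    rw [coboundaries, Submodule.mem_bot] at hf
    have : cup f g = 0 := by ext a; rw [cup_apply, hf]; simp
    rw [this]; exact zero_mem _
  | succ k =>
    obtain ⟨h, rfl⟩ := hf
    refine mem_coboundaries (k := k + l) (by omega) (cup h g) _ fun a => ?_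
    rw [d_cup, hg]
    simp
    rfl

theorem cup_mem_coboundaries_right {k l : ℕ} {f : Cochain R A k} {g : Cochain R A l}
    (hf : f ∈ cocycles R A k) (hg : g ∈ coboundaries R A l) :
    cup f g ∈ coboundaries R A (k + l) := by
  rw [LinearMap.mem_ker] at hf
  cases l with
  | zero =>
    rw [coboundaries, Submodule.mem_bot] at hg
    have : cup f g = 0 := by ext a; rw [cup_apply, hg]; simp
    rw [this]; exact zero_mem _
  | succ l =>
    obtain ⟨h, rfl⟩ := hg
    refine mem_coboundaries (k := k + l) (by omega) ((-1 : R) ^ k • cup f h) _ fun a => ?_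
    rw [map_smul, Cochain.smul_apply, d_cup, hf]
    simp [smul_smul, ← mul_pow]
    rfl

/-- The cup product of a cocycle with a cocycle, as a cohomology class. -/
def cupCocycles (k l : ℕ) : cocycles R A k →ₗ[R] cocycles R A l →ₗ[R] HH R A (k + l) :=
  LinearMap.mk₂ R
    (fun f g => Submodule.Quotient.mk ⟨cup f.1 g.1, cup_mem_cocycles f.2 g.2⟩)
    (fun f f' g => by
      rw [← Submodule.Quotient.mk_add]; congr 1; ext a; simp [add_mul])
    (fun r f g => by
      rw [← Submodule.Quotient.mk_smul]; congr 1; ext a; simp)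
    (fun f g g' => by
      rw [← Submodule.Quotient.mk_add]; congr 1; ext a; simp [mul_add])
    (fun r f g => by
      rw [← Submodule.Quotient.mk_smul]; congr 1; ext a; simp)

/-- The cup product on Hochschild cohomology. -/
def cupHH (k l : ℕ) : HH R A k →ₗ[R] HH R A l →ₗ[R] HH R A (k + l) :=
  Submodule.liftQ _
    { toFun := fun f => Submodule.liftQ _ (cupCocycles k l f) (fun g hg =>
        (Submodule.Quotient.mk_eq_zero _).2 (cup_mem_coboundaries_right f.2 hg))
      map_add' := fun f f' => by
        refine LinearMap.ext fun g => ?_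
        induction g using Submodule.Quotient.induction_on with | H g => ?_
        exact LinearMap.congr_fun (map_add (cupCocycles k l) f f') g
      map_smul' := fun r f => by
        refine LinearMap.ext fun g => ?_
        induction g using Submodule.Quotient.induction_on with | H g => ?_
        exact LinearMap.congr_fun (map_smul (cupCocycles k l) r f) g }
    (fun f hf => by
      rw [LinearMap.mem_ker]
      ext g
      exact (Submodule.Quotient.mk_eq_zero _).2 (cup_mem_coboundaries_left hf g.2))

theorem cupHH_mk {k l : ℕ} (f : cocycles R A k) (g : cocycles R A l) :
    cupHH k l (Submodule.Quotient.mk f) (Submodule.Quotient.mk g) =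
      Submodule.Quotient.mk ⟨cup f.1 g.1, cup_mem_cocycles f.2 g.2⟩ := rfl

variable (R A) in
/-- The class in `HH^0(A; A)` of the scalar `r · 1 ∈ A`. -/
def scalarHH : R →ₗ[R] HH R A 0 where
  toFun r := Submodule.Quotient.mk
    ⟨Cochain.of R A 0 (MultilinearMap.constOfIsEmpty R _ (algebraMap R A r)), by
      rw [LinearMap.mem_ker]
      ext a
      simp [d_apply, Algebra.commutes r (a 0)]⟩
  map_add' r s := by
    rw [← Submodule.Quotient.mk_add]; congr 1; ext a; simp
  map_smul' r s := by
    rw [RingHom.id_apply, ← Submodule.Quotient.mk_smul]; congr 1; ext a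
    simp [Algebra.smul_def]

theorem mk_eq_of_cocycles {k l : ℕ} (h : k = l) (f : cocycles R A k) (g : cocycles R A l)
    (hfg : ∀ a, f.1 (fun i => a (Fin.cast h i)) = g.1 a) :
    (GradedMonoid.mk k (Submodule.Quotient.mk f) : GradedMonoid (HH R A)) =
      GradedMonoid.mk l (Submodule.Quotient.mk g) := by
  subst h
  congr 2
  ext a
  exact hfg a

instance : GradedMonoid.GMul (HH R A) where
  mul {k l} x y := cupHH k l x y

instance : GradedMonoid.GOne (HH R A) where
  one := scalarHH R A 1

instance : GradedMonoid.GMonoid (HH R A) where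
  one_mul := by
    rintro ⟨k, x⟩
    induction x using Submodule.Quotient.induction_on with | H f => ?_
    refine mk_eq_of_cocycles (zero_add k) _ _ fun a => ?_
    refine (cup_apply _ _ _).trans ?_
    simp
  mul_one := by
    rintro ⟨k, x⟩
    induction x using Submodule.Quotient.induction_on with | H f => ?_
    refine mk_eq_of_cocycles (add_zero k) _ _ fun a => ?_
    refine (cup_apply _ _ _).trans ?_
    simp
  mul_assoc := by
    rintro ⟨k, x⟩ ⟨l, y⟩ ⟨m, z⟩
    induction x using Submodule.Quotient.induction_on with | H f => ?_
    induction y using Submodule.Quotient.induction_on with | H g => ?_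
    induction z using Submodule.Quotient.induction_on with | H h => ?_
    refine mk_eq_of_cocycles (add_assoc k l m) _ _ fun a => ?_
    refine (cup_apply _ _ _).trans (Eq.trans ?_ (cup_apply _ _ _).symm)
    refine (congrArg (· * _) (cup_apply _ _ _)).trans
      (Eq.trans ?_ (congrArg (_ * ·) (cup_apply _ _ _)).symm)
    refine (mul_assoc _ _ _).trans ?_
    refine congrArg (fun t => f.1 _ * (g.1 _ * h.1 t)) (funext fun i => congrArg a (Fin.ext ?_))
    exact Nat.add_assoc k l i

instance : DirectSum.GRing (HH R A) where
  mul_zero _ := map_zero _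
  zero_mul y := LinearMap.congr_fun (map_zero (cupHH _ _)) y
  mul_add _ _ _ := map_add _ _ _
  add_mul x y z := LinearMap.congr_fun (map_add (cupHH _ _) x y) z
  natCast n := scalarHH R A n
  natCast_zero := by simp
  natCast_succ n := by rw [Nat.cast_succ, map_add]; rfl
  intCast n := scalarHH R A n
  intCast_ofNat n := by simp
  intCast_negSucc_ofNat n := by
    rw [← map_neg]; congr 1; simp

instance : DirectSum.GAlgebra R (HH R A) where
  toFun := (scalarHH R A).toAddMonoidHom
  map_one := rfl
  map_mul r s := by
    refine mk_eq_of_cocycles rfl _ _ fun a => ?_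
    refine Eq.trans ?_ (cup_apply _ _ _).symm
    simp
  commutes := by
    rintro r ⟨k, x⟩
    induction x using Submodule.Quotient.induction_on with | H f => ?_
    refine mk_eq_of_cocycles (by simp [add_comm]) _ _ fun a => ?_
    refine (cup_apply _ _ _).trans (Eq.trans ?_ (cup_apply _ _ _).symm)
    refine (Algebra.commutes r _).trans ?_
    refine congrArg (fun t => f.1 t * algebraMap R A r)
      (funext fun i => congrArg a (Fin.ext ?_))
    exact Nat.zero_add i
  smul_def := by
    rintro r ⟨k, x⟩
    induction x using Submodule.Quotient.induction_on with | H f => ?_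
    refine mk_eq_of_cocycles (zero_add k).symm _ _ fun a => ?_
    refine Eq.trans ?_ (cup_apply _ _ _).symm
    refine (Algebra.smul_def r (f.1 _)).trans ?_
    refine congrArg (fun t => algebraMap R A r * f.1 t)
      (funext fun i => congrArg a (Fin.ext ?_))
    exact (Nat.zero_add i).symm

variable (R A) in
/-- The Hochschild cohomology ring `HH^*(A; A) = ⨁_k HH^k(A; A)` under the cup product. -/
abbrev HHRing : Type _ := DirectSum ℕ (HH R A)

variable (R A) in
/-- The even part `HH^{2*}(A; A) = ⨁_r HH^{2r}(A; A)` of the Hochschild cohomology ring: the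
subalgebra of the elements whose components in odd degrees vanish. -/
def evenPart : Subalgebra R (HHRing R A) where
  carrier := {ξ | ∀ k, Odd k → ξ k = 0}
  add_mem' {ξ η} hξ hη k hk := by
    change (ξ + η) k = 0
    rw [DirectSum.add_apply, hξ k hk, hη k hk, add_zero]
  mul_mem' {ξ η} hξ hη k hk := by
    classical
    change (ξ * η) k = 0
    rw [DirectSum.mul_eq_sum_support_ghas_mul, DFinsupp.finsetSum_apply]
    refine Finset.sum_eq_zero fun ij hij => ?_
    obtain ⟨hi, hj⟩ := Finset.mem_product.1 hij
    have hi' : Even ij.1 := by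
      by_contra h
      exact (DFinsupp.mem_support_iff.1 hi) (hξ _ (Nat.not_even_iff_odd.1 h))
    have hj' : Even ij.2 := by
      by_contra h
      exact (DFinsupp.mem_support_iff.1 hj) (hη _ (Nat.not_even_iff_odd.1 h))
    refine DirectSum.of_eq_of_ne _ _ _ fun h => ?_
    exact (Nat.not_even_iff_odd.2 hk) (h ▸ hi'.add hj')
  algebraMap_mem' r k hk := by
    refine DirectSum.of_eq_of_ne _ _ _ fun h => ?_
    subst h
    simp at hk

/-- The cochain `f` is a cocycle and its cohomology class is `ξ`. -/
def Represents {k : ℕ} (f : Cochain R A k) (ξ : HH R A k) : Prop :=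
  ∃ hf : f ∈ cocycles R A k, Submodule.Quotient.mk ⟨f, hf⟩ = ξ

end

/-! ### The group ring of a finite cyclic group -/

/-- The group ring `R[ℤ/nℤ]`. -/
abbrev CyclicRing (R : Type*) [CommRing R] (n : ℕ) : Type _ := AddMonoidAlgebra R (ZMod n)

section
variable (R : Type*) [CommRing R] (n : ℕ)

/-- The basis element of `R[ℤ/nℤ]` given by `t ∈ ℤ/nℤ`, that is, `σ ^ t`. -/
def basisElt (t : ZMod n) : CyclicRing R n := AddMonoidAlgebra.single t 1

/-- The generator `σ` of the group `ℤ/nℤ`, as an element of `R[ℤ/nℤ]`. -/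
def sigma : CyclicRing R n := basisElt R n 1

/-- The ideal `(n σ^{n-1})` of `R[ℤ/nℤ]`. -/
def normIdeal : Ideal (CyclicRing R n) :=
  Ideal.span {(n : CyclicRing R n) * sigma R n ^ (n - 1)}

/-- The annihilator `Ann(n σ^{n-1})` in `R[ℤ/nℤ]`. -/
def annIdeal : Ideal (CyclicRing R n) := (normIdeal R n).annihilator

variable {R n} [NeZero n]

/-- The `k`-cochain on `R[ℤ/nℤ]` with prescribed values `c` on tuples of group elements, extended
multilinearly. -/
def extend {k : ℕ} (c : (Fin k → ZMod n) → CyclicRing R n) : Cochain R (CyclicRing R n) k :=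
  Cochain.of R (CyclicRing R n) k <|
    ∑ g : Fin k → ZMod n,
      ((MultilinearMap.mkPiAlgebra R (Fin k) R).compLinearMap fun i =>
        Finsupp.lapply (g i) ∘ₗ (AddMonoidAlgebra.coeffLinearEquiv R).toLinearMap).smulRight (c g)

theorem extend_apply {k : ℕ} (c : (Fin k → ZMod n) → CyclicRing R n)
    (a : Fin k → CyclicRing R n) :
    extend c a = ∑ g : Fin k → ZMod n, (∏ i, (a i).coeff (g i)) • c g := by
  rw [extend, Cochain.of_apply, _root_.sum_apply]
  rfl

theorem extend_basisElt {k : ℕ} (c : (Fin k → ZMod n) → CyclicRing R n)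
    (g : Fin k → ZMod n) : extend c (fun i => basisElt R n (g i)) = c g := by
  classical
  rw [extend_apply, Finset.sum_eq_single g]
  · simp [basisElt]
  · intro h _ hne
    obtain ⟨i, hi⟩ := Function.ne_iff.1 hne
    rw [Finset.prod_eq_zero (Finset.mem_univ i), zero_smul]
    simp [basisElt, hi.symm]
  · simp

/-- The `2r`-cochain attached to `a ∈ A = R[ℤ/nℤ]`: for `0 ≤ i_1, …, i_{2r} < n`,
`(σ^{i_1}, …, σ^{i_{2r}}) ↦ (-1)^r a σ^{i_1 + ⋯ + i_{2r} - rn}` if `i_{2k-1} + i_{2k} ≥ n` for all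
`1 ≤ k ≤ r`, and `0` otherwise. (Exponents of `σ` are read in `ℤ/nℤ`.) -/
def evenCochain (r : ℕ) (a : CyclicRing R n) : Cochain R (CyclicRing R n) (2 * r) :=
  extend fun g =>
    if ∀ k : Fin r, n ≤ (g ⟨2 * k, by omega⟩).val + (g ⟨2 * k + 1, by omega⟩).val then
      (-1) ^ r * (a * basisElt R n (∑ i, g i))
    else 0

/-- The `(2r+1)`-cochain attached to `a ∈ A = R[ℤ/nℤ]`: for `0 ≤ i_1, …, i_{2r+1} < n`,
`(σ^{i_1}, …, σ^{i_{2r+1}}) ↦ (-1)^{r+1} i_1 a σ^{i_1 + ⋯ + i_{2r+1} - rn - 1}` if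
`i_{2k} + i_{2k+1} ≥ n` for all `1 ≤ k ≤ r`, and `0` otherwise. -/
def oddCochain (r : ℕ) (a : CyclicRing R n) : Cochain R (CyclicRing R n) (2 * r + 1) :=
  extend fun g =>
    if ∀ k : Fin r, n ≤ (g ⟨2 * k + 1, by omega⟩).val + (g ⟨2 * k + 2, by omega⟩).val then
      (-1) ^ (r + 1) * (((g 0).val : CyclicRing R n) * (a * basisElt R n (∑ i, g i - 1)))
    else 0

end

end Hochschild

end

/-! The ring `A` is commutative and has a basis of units `σ^i`. Dividing the value of a cochain at
`(σ^{i₁}, …, σ^{i_k})` by `σ^{i₁+⋯+i_k}` therefore turns the Hochschild complex into the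
inhomogeneous complex of `ℤ/nℤ` with trivial coefficients in `A`, and the cup product into the usual
one (`d_twist`, `cup_twist`). What remains is the cohomology of a finite cyclic group, with
products, on explicit cocycles.

Let θ be the carry of addition mod `n`. It is a 2-cocycle, and for `n ≥ 2` cup product with θ is
surjective on cohomology and injective in positive degrees. Both facts come from one cochain-level
statement, `exists_eq_cupCarry_add_groupD`: modulo a coboundary, a cochain that is closed on enough
tuples is a multiple of θ. Up to sign the given cocycles are `a θ^r` and `i₁ b θ^r`, so periodicity
reduces everything to degrees at most 2, where `eq_val_mul_of_additive` decides: the coboundary of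
`i ↦ i x` is `n x θ`. This produces both the quotient by `n` and the `n`-torsion; the power of `σ`
is a unit and plays no role. For `n = 1` the carry is zero and the complex is handled directly.

Almost all products hold already for cochains. Two need a homotopy: moving θ past the degree-one
class (`groupD_two_carry_swap`), and the product of two degree-one classes (`groupD_one_choose`),
where `n(n-1)/2` enters. The formulas in all degrees follow formally (`PeriodicProducts`).

For the presentations, polynomials are evaluated at the generators, and an `R`-linear map back,
defined on the additive generators, is checked to be a left inverse (`exists_quotient_algEquiv`). No
normal form in the quotient ring is needed. -/

namespace Hochschild

/-! ### Inhomogeneous cochains of a cyclic group -/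

section GroupCochains

variable {n : ℕ} {S : Type*} [CommRing S]

/-- Append an entry to a tuple. -/
abbrev snoc {G : Type*} {k : ℕ} (p : Fin k → G) (t : G) : Fin (k + 1) → G :=
  Fin.snoc (α := fun _ => G) p t

/-- The inhomogeneous differential of group cochains of `ℤ/nℤ` with trivial coefficients. -/
def groupD (k : ℕ) : ((Fin k → ZMod n) → S) →ₗ[S] ((Fin (k + 1) → ZMod n) → S) where
  toFun φ g := φ (fun i => g i.succ) +
    ∑ j : Fin k, (-1) ^ ((j : ℕ) + 1) * φ (Fin.contractNth j.castSucc (· + ·) g) +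
    (-1) ^ (k + 1) * φ (fun i => g i.castSucc)
  map_add' φ ψ := by
    ext g
    simp [mul_add, Finset.sum_add_distrib]
    ring
  map_smul' r φ := by
    ext g
    simp [Finset.mul_sum, mul_left_comm, mul_add]

theorem groupD_apply {k : ℕ} (φ : (Fin k → ZMod n) → S) (g : Fin (k + 1) → ZMod n) :
    groupD k φ g = φ (fun i => g i.succ) +
      ∑ j : Fin k, (-1) ^ ((j : ℕ) + 1) * φ (Fin.contractNth j.castSucc (· + ·) g) +
      (-1) ^ (k + 1) * φ (fun i => g i.castSucc) := rfl

theorem contractNth_castSucc_snoc {k : ℕ} (j : Fin k) (g : Fin (k + 1) → ZMod n) (x : ZMod n) :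
    Fin.contractNth j.castSucc.castSucc (· + ·) (snoc g x) =
      snoc (Fin.contractNth j.castSucc (· + ·) g) x := by
  ext i
  refine Fin.lastCases ?_ (fun i => ?_) i
  · rw [Fin.contractNth_apply_of_gt _ _ _ _ (by simp), Fin.succ_last]; simp
  · simp only [Fin.contractNth, Fin.succ_castSucc, Fin.snoc_castSucc, Fin.val_castSucc]

theorem contractNth_last_snoc {k : ℕ} (p : Fin k → ZMod n) (t x : ZMod n) :
    Fin.contractNth (Fin.last k).castSucc (· + ·) (snoc (snoc p t) x) = snoc p (t + x) := by
  ext i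
  refine Fin.lastCases ?_ (fun i => ?_) i
  · rw [Fin.contractNth_apply_of_eq _ _ _ _ (by simp), Fin.succ_last]; simp
  · rw [Fin.contractNth_apply_of_lt _ _ _ _ (by simp)]; simp

/-- Freezing the last argument leaves the differential of a slice plus a correction in the last two
arguments only; the term `φ (snoc p x)` compensates for the final face of the slice. Every later
computation in general degree goes through this recursion, so the alternating sum need not be opened
again. -/
theorem groupD_snoc {k : ℕ} (φ : (Fin (k + 1) → ZMod n) → S) (p : Fin k → ZMod n)
    (t x : ZMod n) :
    groupD (k + 1) φ (snoc (snoc p t) x) = groupD k (fun q => φ (snoc q x)) (snoc p t) +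
      (-1) ^ k * (φ (snoc p x) - φ (snoc p (t + x)) + φ (snoc p t)) := by
  rw [groupD_apply, groupD_apply, Fin.sum_univ_castSucc]
  have h1 : (fun i : Fin (k + 1) => snoc (snoc p t) x i.succ) =
      snoc (fun i : Fin k => snoc p t i.succ) x := by
    ext i
    refine Fin.lastCases ?_ (fun i => ?_) i
    · rw [Fin.succ_last]; simp
    · rw [Fin.succ_castSucc]; simp only [Fin.snoc_castSucc]
  simp only [h1, contractNth_castSucc_snoc, contractNth_last_snoc, Fin.snoc_castSucc, Fin.val_castSucc, Fin.val_last]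
  ring

theorem groupD_zero (φ : (Fin 0 → ZMod n) → S) : groupD 0 φ = 0 := by
  ext g
  simp [groupD_apply, Subsingleton.elim (fun i : Fin 0 => g i.succ) (fun i => g i.castSucc)]

theorem groupD_one (φ : (Fin 1 → ZMod n) → S) (t x : ZMod n) :
    groupD 1 φ ![t, x] = φ ![x] - φ ![t + x] + φ ![t] := by
  have e1 (s : ZMod n) : ![s] = snoc (Fin.elim0 : Fin 0 → ZMod n) s := by
    ext i; fin_cases i; rfl
  have e2 : ![t, x] = snoc (snoc (Fin.elim0 : Fin 0 → ZMod n) t) x := by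
    ext i; fin_cases i <;> rfl
  rw [e2, groupD_snoc, groupD_zero]
  simp [e1]

theorem exists_snoc {k : ℕ} (g : Fin (k + 1) → ZMod n) : ∃ p t, g = snoc p t :=
  ⟨fun i => g i.castSucc, g (Fin.last k), (Fin.snoc_init_self g).symm⟩

/-- Induction on the degree by slicing: the slice of `groupD φ` at `x` is the differential of a
slice of `φ`, killed by the induction hypothesis, plus corrections that cancel. -/
theorem groupD_groupD (k : ℕ) (φ : (Fin k → ZMod n) → S) : groupD (k + 1) (groupD k φ) = 0 := by
  induction k with
  | zero => rw [groupD_zero, map_zero]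
  | succ k ih =>
    ext g
    obtain ⟨g, x, rfl⟩ := exists_snoc g
    obtain ⟨p, y, rfl⟩ := exists_snoc g
    obtain ⟨q, t, rfl⟩ := exists_snoc p
    rw [groupD_snoc]
    have h : (fun g => groupD (k + 1) φ (snoc g x)) =
        groupD k (fun q => φ (snoc q x)) +
          ((-1) ^ k : S) • ((fun g => φ (snoc (fun i => g i.castSucc) x)) -
            (fun g => φ (snoc (fun i => g i.castSucc) (g (Fin.last k) + x))) + φ) := by
      ext g
      obtain ⟨p, y, rfl⟩ := exists_snoc g
      rw [groupD_snoc]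
      simp only [Pi.add_apply, Pi.smul_apply, Pi.sub_apply, Fin.snoc_castSucc, Fin.snoc_last,
        smul_eq_mul]
    rw [h, map_add, ih]
    simp only [map_smul, map_add, map_sub, Pi.add_apply, Pi.smul_apply, Pi.sub_apply,
      groupD_snoc, Fin.snoc_castSucc, Fin.snoc_last, Pi.zero_apply, smul_eq_mul]
    have e (z : ZMod n) : z + y + x = z + (y + x) := add_assoc _ _ _
    simp only [e, add_comm y x, pow_succ]
    ring

/-! ### The carry cocycle -/

variable (n) in
/-- The carry of the addition of `ℤ/nℤ`, an integral `2`-cocycle. -/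
def carry (i j : ZMod n) : ℤ := if n ≤ i.val + j.val then 1 else 0

variable [NeZero n]

theorem mul_carry (i j : ZMod n) : n * carry n i j = i.val + j.val - (i + j).val := by
  unfold carry
  split_ifs with h
  · have := ZMod.val_add_val_of_le h
    push_cast [← @Nat.cast_inj ℤ] at this
    linarith
  · rw [ZMod.val_add_of_lt (by omega)]
    push_cast
    ring

/-- By `mul_carry`, `n` times the carry is the coboundary of the integer-valued function `ZMod.val`,
and `n` can be cancelled in `ℤ`. This is why the carry is taken integral and only then cast to `S`.
-/
theorem carry_cocycle (s t x : ZMod n) :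
    carry n t x - carry n (s + t) x + carry n s (t + x) - carry n s t = 0 := by
  have hn : (n : ℤ) ≠ 0 := by exact_mod_cast NeZero.ne n
  apply mul_left_cancel₀ hn
  have h1 := mul_carry t x
  have h2 := mul_carry (s + t) x
  have h3 := mul_carry s (t + x)
  have h4 := mul_carry s t
  rw [add_assoc s t x] at h2
  linear_combination h1 - h2 + h3 - h4

/-- The cup product of a cochain with the carry cocycle. -/
def cupCarry {k : ℕ} (c : (Fin k → ZMod n) → S) : (Fin (k + 2) → ZMod n) → S := fun g =>
  carry n (g (Fin.last k).castSucc) (g (Fin.last (k + 1))) * c (fun i => g i.castSucc.castSucc)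

omit [NeZero n] in
@[simp] theorem cupCarry_snoc {k : ℕ} (c : (Fin k → ZMod n) → S) (p : Fin k → ZMod n)
    (t x : ZMod n) : cupCarry c (snoc (snoc p t) x) = carry n t x * c p := by
  simp [cupCarry]

/-- The Leibniz rule: the carry is closed, and it stands on the right, so no sign appears. After two
slicings its contribution is a multiple of `carry_cocycle`. -/
theorem groupD_cupCarry {k : ℕ} (c : (Fin k → ZMod n) → S) :
    groupD (k + 2) (cupCarry c) = cupCarry (groupD k c) := by
  ext g
  obtain ⟨g, x, rfl⟩ := exists_snoc g
  obtain ⟨g, t, rfl⟩ := exists_snoc g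
  obtain ⟨p, s, rfl⟩ := exists_snoc g
  rw [groupD_snoc, groupD_snoc, cupCarry_snoc]
  have h : (fun q => cupCarry c (snoc (snoc q t) x)) = (carry n t x : S) • c := by
    ext q; simp
  rw [h, map_smul]
  simp only [cupCarry_snoc, Pi.smul_apply, smul_eq_mul]
  have := congrArg (Int.cast : ℤ → S) (carry_cocycle s t x)
  push_cast at this
  linear_combination (-1) ^ k * c p * this

/-! ### Periodicity under cup product with the carry -/

omit [NeZero n] in
theorem cupCarry_injective (hn : 2 ≤ n) {k : ℕ} {c c' : (Fin k → ZMod n) → S}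
    (h : cupCarry c = cupCarry c') : c = c' := by
  have : Fact (1 < n) := ⟨hn⟩
  ext p
  -- The pair `(n - 1, 1)` carries, so evaluating there recovers the other factor.
  have h1 : carry n (((n - 1 : ℕ) : ZMod n)) 1 = 1 := by
    rw [carry, ZMod.val_natCast_of_lt (by omega), ZMod.val_one, if_pos (by omega)]
  simpa [h1] using congrFun h (snoc (snoc p ((n - 1 : ℕ) : ZMod n)) 1)

omit [NeZero n] in
theorem exists_normalized (hn : 2 ≤ n) {k : ℕ} (f : (Fin (k + 2) → ZMod n) → S) :
    ∃ u : (Fin (k + 1) → ZMod n) → S, ∀ p (t : ℕ), t < n - 1 →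
      groupD (k + 1) u (snoc (snoc p (t : ZMod n)) 1) = f (snoc (snoc p (t : ZMod n)) 1) := by
  have : Fact (1 < n) := ⟨hn⟩
  -- If `u (snoc q 1) = 0` for all `q`, then `groupD_snoc` makes the required equation a difference
  -- equation for `u (snoc p t)` in `t`, solved by a sum. The initial value at `t = 0` is chosen so
  -- that `u` indeed vanishes at `t = 1`.
  let u : (Fin (k + 1) → ZMod n) → S := fun g =>
    (-1) ^ k * (f (snoc (snoc (fun i => g i.castSucc) 0) 1) -
      ∑ s ∈ Finset.range (g (Fin.last k)).val,
        f (snoc (snoc (fun i => g i.castSucc) (s : ZMod n)) 1))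
  have hu : ∀ p t, u (snoc p t) = (-1) ^ k * (f (snoc (snoc p 0) 1) -
      ∑ s ∈ Finset.range t.val, f (snoc (snoc p (s : ZMod n)) 1)) := fun p t => by
    simp only [u, Fin.snoc_castSucc, Fin.snoc_last]
  refine ⟨u, fun p t ht => ?_⟩
  have h0 : ((t : ZMod n)).val = t := ZMod.val_natCast_of_lt (by omega)
  have h1 : ((t : ZMod n) + 1).val = t + 1 := by
    rw [ZMod.val_add_of_lt, h0, ZMod.val_one]
    rw [h0, ZMod.val_one]; omega
  have hk : ((-1 : S) ^ k) * (-1) ^ k = 1 := by rw [← mul_pow]; simp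
  have hz : ∀ q, u (snoc q 1) = 0 := fun q => by rw [hu, ZMod.val_one]; simp
  have hz' : (fun q => u (snoc q 1)) = 0 := funext hz
  rw [groupD_snoc, hz', hz, hu, hu, map_zero, h0, h1, Finset.sum_range_succ]
  simp only [Pi.zero_apply]
  linear_combination f (snoc (snoc p (t : ZMod n)) 1) * hk

/-- Closedness lets the last argument be built up in unit steps, so `f (p, i, j)` is the sum of `f
(p, i + s, 1)` over `s < j`. By normalization only `i + s = n - 1` contributes, and this value is
met, exactly once, precisely when `i + j` carries. -/
theorem eq_cupCarry_of_normalized (hn : 2 ≤ n) {k : ℕ} (f : (Fin (k + 2) → ZMod n) → S)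
    (hf : ∀ p (t : ℕ), t < n - 1 → f (snoc (snoc p (t : ZMod n)) 1) = 0)
    (hd : ∀ p i (j : ℕ), j < n - 1 →
      groupD (k + 2) f (snoc (snoc (snoc p i) (j : ZMod n)) 1) = 0) :
    ∃ c, f = cupCarry c := by
  have : Fact (1 < n) := ⟨hn⟩
  have step : ∀ p i (j : ℕ), j < n - 1 →
      f (snoc (snoc p i) ((j + 1 : ℕ) : ZMod n)) =
        f (snoc (snoc p i) (j : ZMod n)) + f (snoc (snoc p (i + j)) 1) := by
    intro p i j hj
    have h := hd p i j hj
    rw [groupD_snoc, groupD_snoc] at h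
    have h0 : (fun q => f (snoc (snoc q (j : ZMod n)) 1)) = 0 := by
      ext q; exact hf q j hj
    rw [h0, map_zero, hf p j hj] at h
    simp only [Pi.zero_apply] at h
    have hk : ((-1 : S) ^ k) * (-1) ^ k = 1 := by rw [← mul_pow]; simp
    push_cast
    linear_combination (-1) ^ k * h - (f (snoc (snoc p i) ((j : ZMod n) + 1)) -
      f (snoc (snoc p i) (j : ZMod n)) - f (snoc (snoc p (i + j)) 1)) * hk
  have h1 : ∀ p (i : ZMod n), f (snoc (snoc p i) 1) =
      if i.val = n - 1 then f (snoc (snoc p ((n - 1 : ℕ) : ZMod n)) 1) else 0 := by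
    intro p i
    have hi := ZMod.val_lt i
    split_ifs with h
    · rw [← h, ZMod.natCast_zmod_val]
    · rw [← ZMod.natCast_zmod_val i]
      exact hf p i.val (by omega)
  refine ⟨fun p => f (snoc (snoc p ((n - 1 : ℕ) : ZMod n)) 1), ?_⟩
  have main : ∀ (j : ℕ), j < n → ∀ p i, f (snoc (snoc p i) (j : ZMod n)) =
      (carry n i j : S) * f (snoc (snoc p ((n - 1 : ℕ) : ZMod n)) 1) := by
    intro j
    induction j with
    | zero =>
      intro _ p i
      -- At `j = 0` the recursion has the same term on both sides, which forces `f (p, i, 0) = 0`.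
      have h := step p i 0 (by omega)
      have hc : carry n i ((0 : ℕ) : ZMod n) = 0 := by
        have := ZMod.val_lt i
        rw [carry, if_neg]; simpa
      rw [hc]
      simpa using h
    | succ j ih =>
      intro hj p i
      rw [step p i j (by omega), ih (by omega), h1 p (i + j)]
      have hi := ZMod.val_lt i
      have hj1 : ((j : ZMod n)).val = j := ZMod.val_natCast_of_lt (by omega)
      have hj2 : (((j + 1 : ℕ) : ZMod n)).val = j + 1 := ZMod.val_natCast_of_lt hj
      rw [carry, carry, hj1, hj2]
      by_cases h : n ≤ i.val + j
      · have := ZMod.val_add_val_of_le (a := i) (b := (j : ZMod n)) (by rw [hj1]; exact h)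
        rw [hj1] at this
        split_ifs <;> first | (exfalso; omega) | simp
      · rw [ZMod.val_add_of_lt (by rw [hj1]; omega), hj1]
        split_ifs <;> first | (exfalso; omega) | simp
  ext g
  obtain ⟨g, x, rfl⟩ := exists_snoc g
  obtain ⟨p, t, rfl⟩ := exists_snoc g
  have hm := main x.val (ZMod.val_lt x) p t
  rw [ZMod.natCast_zmod_val] at hm
  rw [cupCarry_snoc, hm]

/-- Closedness is demanded only on tuples ending in `(j, 1)` with `j < n - 1`, where there is no
carry. Hence the lemma covers not only cocycles (surjectivity of periodicity) but also cochains
whose differential is a multiple of the carry (injectivity). -/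
theorem exists_eq_cupCarry_add_groupD (hn : 2 ≤ n) {k : ℕ} (f : (Fin (k + 2) → ZMod n) → S)
    (hd : ∀ p i (j : ℕ), j < n - 1 →
      groupD (k + 2) f (snoc (snoc (snoc p i) (j : ZMod n)) 1) = 0) :
    ∃ c u, f = cupCarry c + groupD (k + 1) u := by
  obtain ⟨u, hu⟩ := exists_normalized hn f
  obtain ⟨c, hc⟩ := eq_cupCarry_of_normalized hn (f - groupD (k + 1) u)
    (fun p t ht => by rw [Pi.sub_apply, hu p t ht, sub_self])
    (fun p i j hj => by rw [map_sub, groupD_groupD, sub_zero, hd p i j hj])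
  exact ⟨c, u, by rw [← hc, sub_add_cancel]⟩

theorem exists_cocycle_eq_cupCarry_add_groupD (hn : 2 ≤ n) {k : ℕ}
    (f : (Fin (k + 2) → ZMod n) → S) (hf : groupD (k + 2) f = 0) :
    ∃ c u, groupD k c = 0 ∧ f = cupCarry c + groupD (k + 1) u := by
  obtain ⟨c, u, rfl⟩ := exists_eq_cupCarry_add_groupD hn f (fun p i j _ => by rw [hf]; rfl)
  refine ⟨c, u, cupCarry_injective hn ?_, rfl⟩
  rw [map_add, groupD_groupD, add_zero, groupD_cupCarry] at hf
  rw [hf]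
  ext g
  simp [cupCarry]

theorem exists_groupD_eq_of_cupCarry_eq (hn : 2 ≤ n) {k : ℕ} (c : (Fin (k + 1) → ZMod n) → S)
    (h : (Fin (k + 2) → ZMod n) → S) (hc : cupCarry c = groupD (k + 2) h) :
    ∃ e, c = groupD k e := by
  have : Fact (1 < n) := ⟨hn⟩
  obtain ⟨e, u, rfl⟩ := exists_eq_cupCarry_add_groupD hn h (fun p i j hj => by
    rw [← hc, cupCarry_snoc, carry, ZMod.val_natCast_of_lt (by omega), ZMod.val_one,
      if_neg (by omega)]
    simp)
  refine ⟨e, cupCarry_injective hn ?_⟩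
  rw [hc, map_add, groupD_groupD, add_zero, groupD_cupCarry]

/-! ### Low degrees and the two homotopies -/

theorem eq_val_mul_of_additive (hn : 2 ≤ n) (h : ZMod n → S) (a : S)
    (hh : ∀ i j, h j - h (i + j) + h i = carry n i j * a) :
    (∀ i, h i = i.val * h 1) ∧ a = n * h 1 := by
  have : Fact (1 < n) := ⟨hn⟩
  have key : ∀ j : ℕ, j < n → h (j : ZMod n) = j * h 1 := by
    intro j
    induction j with
    | zero =>
      intro _
      have := hh 0 0
      rw [carry, if_neg (by simp; omega)] at this
      simpa using this
    | succ j ih =>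
      intro hj
      have := hh j 1
      rw [carry, if_neg (by rw [ZMod.val_natCast_of_lt (by omega), ZMod.val_one]; omega)] at this
      rw [ih (by omega)] at this
      push_cast at this ⊢
      linear_combination -this
  refine ⟨fun i => by conv_lhs => rw [← ZMod.natCast_zmod_val i, key _ (ZMod.val_lt i)], ?_⟩
  have h0 := key 0 (by omega)
  -- The wrap-around `(n - 1) + 1 = 0` is the one relation not used so far; it gives `a`.
  have h1 := hh ((n - 1 : ℕ) : ZMod n) 1
  rw [carry, if_pos (by rw [ZMod.val_natCast_of_lt (by omega), ZMod.val_one]; omega),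
    key (n - 1) (by omega)] at h1
  have e : ((n - 1 : ℕ) : ZMod n) + 1 = ((0 : ℕ) : ZMod n) := by
    rw [← Nat.cast_succ, Nat.succ_eq_add_one, Nat.sub_add_cancel (by omega)]; simp
  rw [e, h0] at h1
  rw [Nat.cast_sub (by omega)] at h1
  push_cast at h1
  linear_combination -h1

/-- Since `n b = 0`, the function `x(i) = i b` is additive on `ℤ/nℤ`. In the coboundary of `carry
(i, j) x(i + j)`, the total `x(g₀ + g₁ + g₂)` multiplies the cocycle relation of the carry and drops
out; what is left is the commutator of `x` and the carry. -/
theorem groupD_two_carry_swap (b : S) (hb : n * b = 0) :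
    (fun g : Fin 3 → ZMod n => (carry n (g 0) (g 1) * ((g 2).val * b) : S)) =
      (fun g => carry n (g 1) (g 2) * ((g 0).val * b)) +
      groupD 2 (fun g => carry n (g 0) (g 1) * ((g 0).val + (g 1).val) * b) := by
  ext g
  have hg (i j : ZMod n) : ((i + j).val : S) * b = (i.val + j.val) * b := by
    have := congrArg (Int.cast : ℤ → S) (mul_carry i j)
    push_cast at this
    linear_combination b * this - carry n i j * hb
  have hc := congrArg (Int.cast : ℤ → S) (carry_cocycle (g 0) (g 1) (g 2))
  push_cast at hc
  have h01 := hg (g 0) (g 1)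
  have h12 := hg (g 1) (g 2)
  simp only [Pi.add_apply, groupD_apply, Fin.sum_univ_two, Fin.contractNth]
  simp [-ZMod.natCast_val]
  linear_combination (-((g 0).val + (g 1).val + (g 2).val) * b) * hc
    + (carry n (g 0 + g 1) (g 2)) * h01 - carry n (g 0) (g 1 + g 2) * h12

theorem add_choose_two (i j : ℕ) : (i + j).choose 2 = i.choose 2 + j.choose 2 + i * j := by
  induction j with
  | zero => simp
  | succ j ih =>
    rw [← add_assoc, Nat.choose_succ_succ' (i + j) 1, Nat.choose_succ_succ' j 1, ih]
    simp only [Nat.choose_one_right]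
    ring

/-- The product `i j` is the defect of additivity of the binomial coefficient `C(i, 2)` on integers.
When `i + j` wraps around, `C(i + j, 2)` exceeds its value at the residue by `C(n, 2)` plus a
multiple of `n`, and `e` kills the latter. -/
theorem groupD_one_choose (e : S) (he : n * e = 0) :
    (fun g : Fin 2 → ZMod n => ((g 0).val * ((g 1).val * e) : S)) =
      (fun g => carry n (g 0) (g 1) * ((n * (n - 1) / 2 : ℕ) * e)) +
      groupD 1 (fun g => -((g 0).val.choose 2 : S) * e) := by
  ext g
  have hu (x y : ℕ) := congrArg (Nat.cast : ℕ → S) (add_choose_two x y)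
  push_cast at hu
  rw [Pi.add_apply, groupD_apply, ← Nat.choose_two_right]
  simp [Fin.contractNth, -ZMod.natCast_val]
  by_cases h : n ≤ (g 0).val + (g 1).val
  · have h1 := hu (g 0).val (g 1).val
    rw [ZMod.val_add_val_of_le h, hu] at h1
    rw [carry, if_pos h]
    push_cast
    linear_combination -e * h1 + (g 0 + g 1).val * he
  · rw [carry, if_neg h, ZMod.val_add_of_lt (by omega)]
    push_cast
    linear_combination -e * hu (g 0).val (g 1).val

end GroupCochains

/-! ### Cohomology of the cyclic group on explicit cocycles -/

section Classes

variable {n : ℕ} {S : Type*} [CommRing S]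

variable (n S) in
/-- Coboundaries of the inhomogeneous group cochain complex of `ℤ/nℤ`. -/
def groupCob : (k : ℕ) → Submodule S ((Fin k → ZMod n) → S)
  | 0 => ⊥
  | k + 1 => LinearMap.range (groupD k)

theorem groupD_mem_groupCob {k : ℕ} (u : (Fin k → ZMod n) → S) :
    groupD k u ∈ groupCob n S (k + 1) := ⟨u, rfl⟩

theorem cupCarry_sub {k : ℕ} (c c' : (Fin k → ZMod n) → S) :
    cupCarry (c - c') = cupCarry c - cupCarry c' := by
  ext g; simp [cupCarry, mul_sub]

theorem cupCarry_neg {k : ℕ} (c : (Fin k → ZMod n) → S) :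
    cupCarry (-c) = -cupCarry c := by
  ext g; simp [cupCarry]

/-- The group cochain underlying `evenCochain`. -/
def evenFun (n r : ℕ) (a : S) : (Fin (2 * r) → ZMod n) → S := fun g =>
  if ∀ k : Fin r, n ≤ (g ⟨2 * k, by omega⟩).val + (g ⟨2 * k + 1, by omega⟩).val then
    (-1) ^ r * a else 0

/-- The group cochain `i₁ ⌣ θ ⌣ ⋯ ⌣ θ`, up to sign, with `θ` the carry cocycle. -/
def oddFun (n r : ℕ) (b : S) : (Fin (2 * r + 1) → ZMod n) → S := fun g =>
  if ∀ k : Fin r, n ≤ (g ⟨2 * k + 1, by omega⟩).val + (g ⟨2 * k + 2, by omega⟩).val then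
    (-1) ^ (r + 1) * ((g 0).val * b) else 0

theorem ite_and_eq_neg_mul (P Q : Prop) [Decidable P] [Decidable Q] (k : ℕ) (x : S) :
    (if P ∧ Q then (-1) ^ (k + 1) * x else 0) =
      -(((if Q then 1 else 0 : ℤ) : S) * if P then (-1) ^ k * x else 0) := by
  by_cases hP : P <;> by_cases hQ : Q <;> simp [hP, hQ, pow_succ]

/-- The last pair of the quantified carry condition splits off as one carry factor. This and
`oddFun_succ` are what make induction on `r` by periodicity possible. -/
theorem evenFun_succ (r : ℕ) (a : S) : evenFun n (r + 1) a = -cupCarry (evenFun n r a) := by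
  ext g
  exact (if_congr Fin.forall_fin_succ' rfl rfl).trans (ite_and_eq_neg_mul _ _ r a)

theorem oddFun_succ (r : ℕ) (b : S) : oddFun n (r + 1) b = -cupCarry (oddFun n r b) := by
  ext g
  exact (if_congr Fin.forall_fin_succ' rfl rfl).trans (ite_and_eq_neg_mul _ _ (r + 1) _)

theorem evenFun_zero (a : S) : evenFun n 0 a = fun _ => a := by
  ext g; simp [evenFun]

theorem oddFun_zero (b : S) : oddFun n 0 b = fun g => -((g 0).val * b) := by
  ext g; simp [oddFun]

theorem evenFun_neg (r : ℕ) (a : S) : evenFun n r (-a) = -evenFun n r a := by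
  ext g; simp only [evenFun, Pi.neg_apply]; split_ifs <;> simp

theorem oddFun_neg (r : ℕ) (a : S) : oddFun n r (-a) = -oddFun n r a := by
  ext g; simp only [oddFun, Pi.neg_apply]; split_ifs <;> simp

theorem tuple_one_eq (g : Fin 1 → ZMod n) : g = ![g 0] := by
  ext i; fin_cases i; rfl

theorem tuple_two_eq (g : Fin 2 → ZMod n) : g = ![g 0, g 1] := by
  ext i; fin_cases i <;> rfl

variable [NeZero n]

theorem groupD_evenFun (r : ℕ) (a : S) : groupD (2 * r) (evenFun n r a) = 0 := by
  induction r with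
  | zero => exact groupD_zero _
  | succ r ih =>
    rw [evenFun_succ]
    refine (map_neg (groupD (2 * r + 2)) _).trans ?_
    rw [groupD_cupCarry, ih]
    ext g; simp [cupCarry]

/-- The source of `n` in the answer: it makes multiples of `n` exact in degree 2 and limits
degree-one cocycles to `n`-torsion coefficients. -/
theorem groupD_val (b : S) : groupD 1 (fun g : Fin 1 → ZMod n => ((g 0).val * b : S)) =
    cupCarry (fun _ : Fin 0 → ZMod n => n * b) := by
  ext g
  rw [tuple_two_eq g, groupD_one]
  have := congrArg (Int.cast : ℤ → S) (mul_carry (g 0) (g 1))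
  push_cast at this
  simp [cupCarry, -ZMod.natCast_val]
  linear_combination -b * this

theorem groupD_oddFun (r : ℕ) {b : S} (hb : n * b = 0) :
    groupD (2 * r + 1) (oddFun n r b) = 0 := by
  induction r with
  | zero =>
    rw [oddFun_zero]
    refine (map_neg (groupD 1) (fun g : Fin 1 → ZMod n => ((g 0).val * b : S))).trans ?_
    rw [groupD_val, hb]
    ext g; simp [cupCarry]
  | succ r ih =>
    rw [oddFun_succ]
    refine (map_neg (groupD (2 * r + 1 + 2)) _).trans ?_
    rw [groupD_cupCarry, ih]
    ext g; simp [cupCarry]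

theorem cupCarry_mem_groupCob {k : ℕ} {c : (Fin k → ZMod n) → S} (hc : c ∈ groupCob n S k) :
    cupCarry c ∈ groupCob n S (k + 2) := by
  cases k with
  | zero =>
    obtain rfl : c = 0 := hc
    rw [show cupCarry (0 : (Fin 0 → ZMod n) → S) = 0 by ext g; simp [cupCarry]]
    exact zero_mem _
  | succ k =>
    obtain ⟨u, rfl⟩ := hc
    rw [← groupD_cupCarry]
    exact groupD_mem_groupCob _

theorem exists_sub_cupCarry_mem (hn : 2 ≤ n) {k : ℕ} {f : (Fin (k + 2) → ZMod n) → S}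
    (hf : groupD (k + 2) f = 0) :
    ∃ c, groupD k c = 0 ∧ f - cupCarry c ∈ groupCob n S (k + 2) := by
  obtain ⟨c, u, hc, rfl⟩ := exists_cocycle_eq_cupCarry_add_groupD hn f hf
  exact ⟨c, hc, by rw [add_sub_cancel_left]; exact groupD_mem_groupCob u⟩

theorem mem_groupCob_of_cupCarry (hn : 2 ≤ n) {k : ℕ} {c : (Fin (k + 1) → ZMod n) → S}
    (hc : cupCarry c ∈ groupCob n S (k + 3)) : c ∈ groupCob n S (k + 1) := by
  obtain ⟨h, hh⟩ := hc
  obtain ⟨e, rfl⟩ := exists_groupD_eq_of_cupCarry_eq hn c h hh.symm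
  exact groupD_mem_groupCob e

theorem exists_sub_evenFun_mem (hn : 2 ≤ n) (r : ℕ) {f : (Fin (2 * r) → ZMod n) → S}
    (hf : groupD (2 * r) f = 0) : ∃ a, f - evenFun n r a ∈ groupCob n S (2 * r) := by
  induction r with
  | zero =>
    refine ⟨f Fin.elim0, ?_⟩
    have : f = evenFun n 0 (f Fin.elim0) := by
      ext g
      rw [evenFun_zero]
      exact congrArg f (funext fun i => i.elim0)
    rw [← this, sub_self]
    exact zero_mem _
  | succ r ih =>
    obtain ⟨c, hc, hfc⟩ := exists_sub_cupCarry_mem hn hf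
    obtain ⟨a, ha⟩ := ih hc
    refine ⟨-a, ?_⟩
    have := add_mem hfc (cupCarry_mem_groupCob ha)
    rw [cupCarry_sub, sub_add_sub_cancel] at this
    rw [evenFun_succ, evenFun_neg, cupCarry_neg, neg_neg]
    exact this

theorem exists_sub_oddFun_mem (hn : 2 ≤ n) (r : ℕ) {f : (Fin (2 * r + 1) → ZMod n) → S}
    (hf : groupD (2 * r + 1) f = 0) :
    ∃ b : S, n * b = 0 ∧ f - oddFun n r b ∈ groupCob n S (2 * r + 1) := by
  induction r with
  | zero =>
    obtain ⟨h1, h2⟩ := eq_val_mul_of_additive (S := S) hn (fun i => f ![i]) 0 (fun i j => by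
      refine Eq.trans ?_ (mul_zero _).symm
      exact (groupD_one (S := S) f i j).symm.trans (congrFun hf _))
    -- A degree-one cocycle is determined by its value at `1`; the sign matches the `(-1)^(r+1)` in
    -- `oddFun`.
    refine ⟨-f ![1], by linear_combination h2, ?_⟩
    have : f = oddFun n 0 (-f ![1]) := by
      ext g
      rw [oddFun_zero, tuple_one_eq g]
      have := h1 (g 0)
      simp only [Matrix.cons_val_zero]
      linear_combination this
    rw [← this, sub_self]
    exact zero_mem _
  | succ r ih =>
    obtain ⟨c, hc, hfc⟩ := exists_sub_cupCarry_mem hn hf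
    obtain ⟨b, hb, hcb⟩ := ih hc
    refine ⟨-b, by linear_combination -hb, ?_⟩
    have := add_mem hfc (cupCarry_mem_groupCob hcb)
    rw [cupCarry_sub, sub_add_sub_cancel] at this
    rw [oddFun_succ, oddFun_neg, cupCarry_neg, neg_neg]
    exact this

theorem evenFun_mem_groupCob_of_eq (r : ℕ) (x : S) :
    evenFun n (r + 1) (n * x) ∈ groupCob n S (2 * (r + 1)) := by
  induction r with
  | zero =>
    rw [evenFun_succ, evenFun_zero]
    refine neg_mem ?_
    have := groupD_mem_groupCob (fun g : Fin 1 → ZMod n => ((g 0).val * x : S))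
    rwa [groupD_val] at this
  | succ r ih =>
    rw [evenFun_succ]
    exact neg_mem (cupCarry_mem_groupCob ih)

theorem exists_eq_mul_of_evenFun_mem (hn : 2 ≤ n) (r : ℕ) {a : S}
    (ha : evenFun n (r + 1) a ∈ groupCob n S (2 * (r + 1))) : ∃ x, a = n * x := by
  induction r with
  | zero =>
    rw [evenFun_succ, evenFun_zero] at ha
    obtain ⟨h, hh⟩ := neg_mem_iff.1 ha
    refine ⟨h ![1], (eq_val_mul_of_additive (S := S) hn (fun i => h ![i]) a fun i j => ?_).2⟩
    refine (groupD_one (S := S) h i j).symm.trans ((congrFun hh ![i, j]).trans ?_)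
    rfl
  | succ r ih =>
    rw [evenFun_succ] at ha
    exact ih (mem_groupCob_of_cupCarry hn (neg_mem_iff.1 ha))

theorem eq_zero_of_oddFun_mem (hn : 2 ≤ n) (r : ℕ) {b : S}
    (hb : oddFun n r b ∈ groupCob n S (2 * r + 1)) : b = 0 := by
  have : Fact (1 < n) := ⟨hn⟩
  induction r with
  | zero =>
    rw [oddFun_zero] at hb
    obtain ⟨h, hh⟩ := hb
    have h1 := congrFun hh ![1]
    rw [show groupD (2 * 0) h = 0 from groupD_zero h] at h1
    simpa [ZMod.val_one] using h1
  | succ r ih =>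
    rw [oddFun_succ] at hb
    exact ih (mem_groupCob_of_cupCarry hn (neg_mem_iff.1 hb))

-- For `n = 1` all faces agree, so the differential is an alternating sum of signs: zero or the
-- identity according to parity. This replaces periodicity, which fails because the carry is
-- identically zero.
omit [NeZero n] in
theorem groupD_eq_mul_of_subsingleton [Subsingleton (ZMod n)] {k : ℕ}
    (φ : (Fin k → ZMod n) → S) (g : Fin (k + 1) → ZMod n) :
    groupD k φ g = (if Even k then 0 else 1) * φ 0 := by
  rw [groupD_apply]
  have (p : Fin k → ZMod n) : φ p = φ 0 := congrArg φ (Subsingleton.elim _ _)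
  simp only [this]
  have h := neg_one_geom_sum (R := S) (n := k + 2)
  rw [Finset.sum_range_succ, Finset.sum_range_succ', Finset.sum_range] at h
  have e : (if Even (k + 2) then (0 : S) else 1) = if Even k then 0 else 1 := by
    simp [Nat.even_add]
  rw [← e, ← h, ← Finset.sum_mul]
  ring

omit [NeZero n] in
theorem mem_groupCob_of_subsingleton [Subsingleton (ZMod n)] {k : ℕ}
    {φ : (Fin (k + 1) → ZMod n) → S} (h : groupD (k + 1) φ = 0) : φ ∈ groupCob n S (k + 1) := by
  have h0 := congrFun h 0
  rw [groupD_eq_mul_of_subsingleton] at h0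
  refine ⟨fun _ => φ 0, ?_⟩
  ext g
  rw [groupD_eq_mul_of_subsingleton, Subsingleton.elim g 0]
  rcases Nat.even_or_odd k with hk | hk
  · rw [if_neg (by simpa [Nat.even_add_one] using hk)] at h0
    simp at h0
    simp [h0]
  · rw [if_neg (Nat.not_even_iff_odd.2 hk), one_mul]

end Classes

/-! ### From group cochains to Hochschild cochains -/

section Twist

variable {R : Type*} [CommRing R] {n : ℕ}

variable (R n) in
/-- The basis of `R[ℤ/nℤ]` given by the group elements. -/
noncomputable def groupBasis : Module.Basis (ZMod n) R (CyclicRing R n) :=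
  Module.Basis.ofRepr (AddMonoidAlgebra.coeffLinearEquiv R)

theorem groupBasis_apply (t : ZMod n) : groupBasis R n t = basisElt R n t := by
  rw [groupBasis, Module.Basis.apply_eq_iff]
  ext; rfl

theorem basisElt_mul (s t : ZMod n) : basisElt R n s * basisElt R n t = basisElt R n (s + t) := by
  simp [basisElt, AddMonoidAlgebra.single_mul_single]

@[simp] theorem basisElt_zero : basisElt R n 0 = 1 := rfl

theorem sigma_pow (k : ℕ) : sigma R n ^ k = basisElt R n k := by
  simp [sigma, basisElt, AddMonoidAlgebra.single_pow]

theorem cochain_ext_basisElt {k : ℕ} {f f' : Cochain R (CyclicRing R n) k}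
    (h : ∀ g : Fin k → ZMod n, f (fun i => basisElt R n (g i)) = f' fun i => basisElt R n (g i)) :
    f = f' := by
  have : (Cochain.of R (CyclicRing R n) k).symm f = (Cochain.of R (CyclicRing R n) k).symm f' :=
    Module.Basis.ext_multilinear (fun _ => groupBasis R n) fun g => by
      simp only [groupBasis_apply]
      exact h g
  exact (Cochain.of R (CyclicRing R n) k).symm.injective this

variable [NeZero n]

/-- The Hochschild cochain `(σ^{i₁}, …, σ^{i_k}) ↦ φ(i₁, …, i_k) σ^{i₁ + ⋯ + i_k}`. -/
noncomputable def twist {k : ℕ} (φ : (Fin k → ZMod n) → CyclicRing R n) : Cochain R (CyclicRing R n) k :=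
  extend fun g => φ g * basisElt R n (∑ i, g i)

theorem twist_basisElt {k : ℕ} (φ : (Fin k → ZMod n) → CyclicRing R n) (g : Fin k → ZMod n) :
    twist φ (fun i => basisElt R n (g i)) = φ g * basisElt R n (∑ i, g i) :=
  extend_basisElt _ g

theorem exists_eq_twist {k : ℕ} (f : Cochain R (CyclicRing R n) k) : ∃ φ, f = twist φ := by
  refine ⟨fun g => f (fun i => basisElt R n (g i)) * basisElt R n (-∑ i, g i), ?_⟩
  refine cochain_ext_basisElt fun g => ?_
  rw [twist_basisElt, mul_assoc, basisElt_mul, neg_add_cancel, basisElt_zero, mul_one]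

theorem twist_injective {k : ℕ} {φ ψ : (Fin k → ZMod n) → CyclicRing R n}
    (h : twist φ = twist ψ) : φ = ψ := by
  ext1 g
  have := congrArg (fun f => f (fun i => basisElt R n (g i)) * basisElt R n (-∑ i, g i)) h
  simpa only [twist_basisElt, mul_assoc, basisElt_mul, add_neg_cancel, basisElt_zero, mul_one]
    using this

theorem twist_add {k : ℕ} (φ ψ : (Fin k → ZMod n) → CyclicRing R n) :
    twist (φ + ψ) = twist φ + twist ψ :=
  cochain_ext_basisElt fun g => by simp [twist_basisElt, add_mul]

theorem twist_sub {k : ℕ} (φ ψ : (Fin k → ZMod n) → CyclicRing R n) :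
    twist (φ - ψ) = twist φ - twist ψ := by
  rw [eq_sub_iff_add_eq, ← twist_add, sub_add_cancel]

theorem twist_smul {k : ℕ} (r : R) (φ : (Fin k → ZMod n) → CyclicRing R n) :
    twist (r • φ) = r • twist φ :=
  cochain_ext_basisElt fun g => by simp [twist_basisElt]

omit [NeZero n] in
theorem sum_contractNth {k : ℕ} (j : Fin k) (g : Fin (k + 1) → ZMod n) :
    ∑ i, Fin.contractNth j.castSucc (· + ·) g i = ∑ i, g i := by
  induction k with
  | zero => exact j.elim0
  | succ k ih =>
    obtain ⟨g, x, rfl⟩ := exists_snoc g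
    obtain ⟨p, t, rfl⟩ := exists_snoc g
    refine Fin.lastCases ?_ (fun j => ?_) j
    · rw [contractNth_last_snoc]
      simp [Fin.sum_univ_castSucc, add_assoc]
    · rw [contractNth_castSucc_snoc, Fin.sum_univ_castSucc, Fin.sum_univ_castSucc (snoc _ x)]
      simp only [Fin.snoc_castSucc, Fin.snoc_last, ih]

omit [NeZero n] in
theorem contractNth_basisElt {k : ℕ} (j : Fin k) (g : Fin (k + 1) → ZMod n) :
    Fin.contractNth j.castSucc (· * ·) (fun i => basisElt R n (g i)) =
      fun i => basisElt R n (Fin.contractNth j.castSucc (· + ·) g i) := by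
  ext1 i
  simp only [Fin.contractNth, basisElt_mul]
  split_ifs <;> rfl

/-- Multiplying the group elements in a tuple preserves their total, and the outer factors `a 0` and
`a (Fin.last k)` restore the entry missing from it. Commutativity of `A` moves them into place, so
the coefficients carry the trivial action. -/
theorem d_twist {k : ℕ} (φ : (Fin k → ZMod n) → CyclicRing R n) :
    d R (CyclicRing R n) k (twist φ) = twist (groupD k φ) := by
  refine cochain_ext_basisElt fun g => ?_
  have hs (j : ℕ) (x : CyclicRing R n) : (-1 : R) ^ j • x = (-1) ^ j * x := by
    rw [Algebra.smul_def, map_pow, map_neg, map_one]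
  rw [d_apply, twist_basisElt (groupD k φ), groupD_apply, twist_basisElt, twist_basisElt,
    add_mul, add_mul, Finset.sum_mul]
  refine congrArg₂ _ (congrArg₂ _ ?_ (Finset.sum_congr rfl fun j _ => ?_)) ?_
  · rw [Fin.sum_univ_succ, ← basisElt_mul, mul_left_comm]
  · rw [contractNth_basisElt, twist_basisElt, sum_contractNth, hs, mul_assoc]
  · rw [Fin.sum_univ_castSucc, ← basisElt_mul, hs, mul_assoc, mul_assoc]

theorem twist_mem_cocycles {k : ℕ} {φ : (Fin k → ZMod n) → CyclicRing R n} :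
    twist φ ∈ cocycles R (CyclicRing R n) k ↔ groupD k φ = 0 := by
  rw [LinearMap.mem_ker, d_twist]
  constructor
  · intro h
    refine twist_injective (h.trans ?_)
    exact cochain_ext_basisElt fun g => by simp [twist_basisElt]
  · intro h
    rw [h]
    exact cochain_ext_basisElt fun g => by simp [twist_basisElt]

theorem twist_mem_coboundaries {k : ℕ} {φ : (Fin k → ZMod n) → CyclicRing R n} :
    twist φ ∈ coboundaries R (CyclicRing R n) k ↔ φ ∈ groupCob n (CyclicRing R n) k := by
  cases k with
  | zero =>
    change twist φ = 0 ↔ φ = 0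
    rw [show (0 : Cochain R (CyclicRing R n) 0) = twist 0 from
      cochain_ext_basisElt fun g => by simp [twist_basisElt]]
    exact ⟨twist_injective, congrArg _⟩
  | succ k =>
    constructor
    · rintro ⟨f, hf⟩
      obtain ⟨u, rfl⟩ := exists_eq_twist f
      rw [d_twist] at hf
      exact ⟨u, twist_injective hf⟩
    · rintro ⟨u, rfl⟩
      exact ⟨twist u, d_twist u⟩

theorem cup_twist {k l : ℕ} (φ : (Fin k → ZMod n) → CyclicRing R n)
    (ψ : (Fin l → ZMod n) → CyclicRing R n) :
    cup (twist φ) (twist ψ) =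
      twist fun g => φ (fun i => g (Fin.castAdd l i)) * ψ (fun i => g (Fin.natAdd k i)) := by
  refine cochain_ext_basisElt fun g => ?_
  rw [cup_apply, twist_basisElt, twist_basisElt, twist_basisElt, Fin.sum_univ_add, ← basisElt_mul]
  ring

theorem evenCochain_eq_twist (r : ℕ) (a : CyclicRing R n) :
    evenCochain r a = twist (evenFun n r a) := by
  rw [evenCochain, twist]
  congr 1
  ext1 g
  simp only [evenFun, ite_mul, zero_mul, mul_assoc]

/-- The `-1` in the exponent becomes a factor `σ⁻¹` of the coefficient. A product of two odd classes
therefore carries `σ⁻²`, the origin of `σ^(n-2)`. -/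
theorem oddCochain_eq_twist (r : ℕ) (b : CyclicRing R n) :
    oddCochain r b = twist (oddFun n r (b * basisElt R n (-1))) := by
  rw [oddCochain, twist]
  congr 1
  ext1 g
  simp only [oddFun, ite_mul, zero_mul, mul_assoc, basisElt_mul, sub_eq_neg_add]

end Twist

/-! ### The ideal generated by `n` and the `n`-torsion -/

section Ideals

variable {R : Type*} [CommRing R] {n : ℕ}

theorem sigma_pow_mul_basisElt (k : ℕ) :
    sigma R n ^ k * basisElt R n (-(k : ZMod n)) = 1 := by
  rw [sigma_pow, basisElt_mul, add_neg_cancel, basisElt_zero]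

theorem mem_annIdeal {b : CyclicRing R n} : b ∈ annIdeal R n ↔ n * b = 0 := by
  rw [annIdeal, normIdeal, Submodule.mem_annihilator_span_singleton, smul_eq_mul]
  constructor
  · intro h
    linear_combination basisElt R n (-((n - 1 : ℕ) : ZMod n)) * h -
      n * b * sigma_pow_mul_basisElt (R := R) (n := n) (n - 1)
  · intro h
    linear_combination sigma R n ^ (n - 1) * h

theorem mem_normIdeal {a : CyclicRing R n} : a ∈ normIdeal R n ↔ ∃ x, a = n * x := by
  rw [normIdeal, Ideal.mem_span_singleton']
  constructor
  · rintro ⟨x, rfl⟩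
    exact ⟨x * sigma R n ^ (n - 1), by ring⟩
  · rintro ⟨x, rfl⟩
    refine ⟨x * basisElt R n (-((n - 1 : ℕ) : ZMod n)), ?_⟩
    linear_combination n * x * sigma_pow_mul_basisElt (R := R) (n := n) (n - 1)

end Ideals

/-! ### Hochschild cohomology as a module -/

section TwistClass

variable {R : Type*} [CommRing R] {n : ℕ} [NeZero n]

/-- The class in the Hochschild cohomology ring of the cocycle attached to a group cocycle. -/
noncomputable def twistClass {k : ℕ} (φ : (Fin k → ZMod n) → CyclicRing R n)
    (hφ : groupD k φ = 0) : HHRing R (CyclicRing R n) :=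
  DirectSum.of (HH R (CyclicRing R n)) k
    (Submodule.Quotient.mk ⟨twist φ, twist_mem_cocycles.2 hφ⟩)

theorem mk_twist_eq_iff {k : ℕ} {φ ψ : (Fin k → ZMod n) → CyclicRing R n}
    (hφ : groupD k φ = 0) (hψ : groupD k ψ = 0) :
    (Submodule.Quotient.mk ⟨twist φ, twist_mem_cocycles.2 hφ⟩ : HH R (CyclicRing R n) k) =
      Submodule.Quotient.mk ⟨twist ψ, twist_mem_cocycles.2 hψ⟩ ↔
      φ - ψ ∈ groupCob n (CyclicRing R n) k := by
  rw [Submodule.Quotient.eq, ← twist_mem_coboundaries (R := R), twist_sub]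
  rfl

theorem twistClass_mul {k l : ℕ} {φ : (Fin k → ZMod n) → CyclicRing R n}
    {ψ : (Fin l → ZMod n) → CyclicRing R n} (hφ : groupD k φ = 0) (hψ : groupD l ψ = 0)
    {χ : (Fin (k + l) → ZMod n) → CyclicRing R n} (hχ : groupD (k + l) χ = 0)
    (h : (fun g : Fin (k + l) → ZMod n =>
      φ (fun i => g (Fin.castAdd l i)) * ψ (fun i => g (Fin.natAdd k i))) - χ ∈
        groupCob n (CyclicRing R n) (k + l)) :
    twistClass φ hφ * twistClass ψ hψ = twistClass χ hχ := by
  rw [twistClass, twistClass, twistClass, DirectSum.of_mul_of]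
  refine congrArg _ ((Submodule.Quotient.eq _).2 ?_)
  rw [← twist_mem_coboundaries (R := R), twist_sub, ← cup_twist] at h
  exact h

theorem twistClass_mul_of_eq {k l : ℕ} {φ : (Fin k → ZMod n) → CyclicRing R n}
    {ψ : (Fin l → ZMod n) → CyclicRing R n} (hφ : groupD k φ = 0) (hψ : groupD l ψ = 0)
    {χ : (Fin (k + l) → ZMod n) → CyclicRing R n} (hχ : groupD (k + l) χ = 0)
    (h : ∀ g : Fin (k + l) → ZMod n,
      φ (fun i => g (Fin.castAdd l i)) * ψ (fun i => g (Fin.natAdd k i)) = χ g) :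
    twistClass φ hφ * twistClass ψ hψ = twistClass χ hχ :=
  twistClass_mul hφ hψ hχ (by rw [funext h, sub_self]; exact zero_mem _)

omit [NeZero n] in
theorem n_mul_annIdeal_mul (b : annIdeal R n) (c : CyclicRing R n) :
    (n : CyclicRing R n) * (b * c) = 0 := by
  rw [← mul_assoc, mem_annIdeal.1 b.2, zero_mul]

variable (R n) in
/-- The class of the even cocycle attached to an element of `R[ℤ/nℤ]`. -/
noncomputable def evenClass (r : ℕ) : CyclicRing R n →ₗ[R] HH R (CyclicRing R n) (2 * r) where
  toFun a := Submodule.Quotient.mk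
    ⟨twist (evenFun n r a), twist_mem_cocycles.2 (groupD_evenFun r a)⟩
  map_add' a b := by
    rw [← Submodule.Quotient.mk_add]
    refine congrArg _ (Subtype.ext ((congrArg twist ?_).trans (twist_add _ _)))
    ext1 g; simp only [evenFun, Pi.add_apply]; split_ifs <;> simp [mul_add]
  map_smul' x a := by
    rw [RingHom.id_apply, ← Submodule.Quotient.mk_smul]
    refine congrArg _ (Subtype.ext ((congrArg twist ?_).trans (twist_smul _ _)))
    ext1 g; simp only [evenFun, Pi.smul_apply]; split_ifs <;> simp

variable (R n) in
/-- The class of the odd cocycle attached to an element of `Ann(n σ^{n-1})`. -/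
noncomputable def oddClass (r : ℕ) : annIdeal R n →ₗ[R] HH R (CyclicRing R n) (2 * r + 1) where
  toFun b := Submodule.Quotient.mk ⟨twist (oddFun n r (b * basisElt R n (-1))),
    twist_mem_cocycles.2 (groupD_oddFun r (n_mul_annIdeal_mul b _))⟩
  map_add' a b := by
    rw [← Submodule.Quotient.mk_add]
    refine congrArg _ (Subtype.ext ((congrArg twist ?_).trans (twist_add _ _)))
    ext1 g; simp only [oddFun, Pi.add_apply]; split_ifs <;> simp [mul_add, add_mul]
  map_smul' x a := by
    rw [RingHom.id_apply, ← Submodule.Quotient.mk_smul]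
    refine congrArg _ (Subtype.ext ((congrArg twist ?_).trans (twist_smul _ _)))
    ext1 g; simp only [oddFun, Pi.smul_apply]; split_ifs <;> simp

theorem represents_evenClass (r : ℕ) (a : CyclicRing R n) :
    Represents (evenCochain r a) (evenClass R n r a) := by
  rw [evenCochain_eq_twist]
  exact ⟨_, rfl⟩

theorem represents_oddClass (r : ℕ) (b : annIdeal R n) :
    Represents (oddCochain r (b : CyclicRing R n)) (oddClass R n r b) := by
  rw [oddCochain_eq_twist]
  exact ⟨_, rfl⟩

theorem exists_eq_mk_twist {k : ℕ} (ξ : HH R (CyclicRing R n) k) :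
    ∃ (φ : (Fin k → ZMod n) → CyclicRing R n) (hφ : groupD k φ = 0),
      ξ = Submodule.Quotient.mk ⟨twist φ, twist_mem_cocycles.2 hφ⟩ := by
  induction ξ using Submodule.Quotient.induction_on with | H f => ?_
  obtain ⟨f, hf⟩ := f
  obtain ⟨φ, rfl⟩ := exists_eq_twist f
  exact ⟨φ, twist_mem_cocycles.1 hf, rfl⟩

theorem subsingleton_HH_of_subsingleton [Subsingleton (ZMod n)] (k : ℕ) :
    Subsingleton (HH R (CyclicRing R n) (k + 1)) := by
  refine ⟨fun ξ η => ?_⟩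
  obtain ⟨φ, hφ, rfl⟩ := exists_eq_mk_twist ξ
  obtain ⟨ψ, hψ, rfl⟩ := exists_eq_mk_twist η
  rw [mk_twist_eq_iff hφ hψ]
  exact mem_groupCob_of_subsingleton (by rw [map_sub, hφ, hψ, sub_zero])

theorem evenClass_surjective (r : ℕ) : Function.Surjective (evenClass R n r) := by
  intro ξ
  obtain ⟨φ, hφ, rfl⟩ := exists_eq_mk_twist ξ
  have key : ∃ a, φ - evenFun n r a ∈ groupCob n (CyclicRing R n) (2 * r) := by
    rcases Nat.lt_or_ge 1 n with hn | hn
    · exact exists_sub_evenFun_mem hn r hφ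
    · obtain rfl : n = 1 := le_antisymm hn (NeZero.one_le)
      cases r with
      | zero =>
        refine ⟨φ 0, ?_⟩
        rw [evenFun_zero, show φ = (fun _ => φ 0) from
          funext fun g => congrArg φ (Subsingleton.elim _ _), sub_self]
        exact zero_mem _
      | succ r =>
        refine ⟨0, mem_groupCob_of_subsingleton (k := 2 * r + 1) ?_⟩
        refine (map_sub (groupD (2 * (r + 1))) _ _).trans ?_
        rw [hφ, groupD_evenFun, sub_zero]
  obtain ⟨a, ha⟩ := key
  exact ⟨a, ((mk_twist_eq_iff hφ (groupD_evenFun r a)).2 ha).symm⟩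

theorem evenClass_eq_zero_iff {r : ℕ} {a : CyclicRing R n} :
    evenClass R n r a = 0 ↔ evenFun n r a ∈ groupCob n (CyclicRing R n) (2 * r) := by
  have h0 : evenFun n r (0 : CyclicRing R n) = 0 := by ext1 g; simp [evenFun]
  rw [← map_zero (evenClass R n r)]
  refine (mk_twist_eq_iff (groupD_evenFun r a) (groupD_evenFun r 0)).trans ?_
  rw [h0, sub_zero]

theorem evenClass_zero_bijective : Function.Bijective (evenClass R n 0) := by
  refine ⟨(injective_iff_map_eq_zero _).2 fun a ha => ?_, evenClass_surjective 0⟩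
  rw [evenClass_eq_zero_iff, evenFun_zero] at ha
  exact congrFun ((Submodule.mem_bot _).1 ha) Fin.elim0

theorem ker_evenClass_succ (r : ℕ) :
    LinearMap.ker (evenClass R n (r + 1)) = (normIdeal R n).restrictScalars R := by
  ext a
  rw [LinearMap.mem_ker, Submodule.restrictScalars_mem, mem_normIdeal]
  rcases Nat.lt_or_ge 1 n with hn | hn
  · rw [evenClass_eq_zero_iff]
    refine ⟨exists_eq_mul_of_evenFun_mem hn r, ?_⟩
    rintro ⟨x, rfl⟩
    exact evenFun_mem_groupCob_of_eq r x
  · obtain rfl : n = 1 := le_antisymm hn (NeZero.one_le)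
    have := subsingleton_HH_of_subsingleton (R := R) (n := 1) (2 * r + 1)
    exact ⟨fun _ => ⟨a, by simp⟩, fun _ => this.elim _ _⟩

theorem oddClass_bijective (r : ℕ) : Function.Bijective (oddClass R n r) := by
  rcases Nat.lt_or_ge 1 n with hn | hn
  · constructor
    · refine (injective_iff_map_eq_zero _).2 fun b hb => ?_
      rw [← map_zero (oddClass R n r)] at hb
      have h := (mk_twist_eq_iff (groupD_oddFun r (n_mul_annIdeal_mul b _))
        (groupD_oddFun r (n_mul_annIdeal_mul 0 _))).1 hb
      have h0 : oddFun n r (((0 : annIdeal R n) : CyclicRing R n) * basisElt R n (-1)) = 0 := by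
        ext1 g; simp [oddFun]
      rw [h0, sub_zero] at h
      have h1 := eq_zero_of_oddFun_mem hn r h
      ext1
      have h2 := sigma_pow_mul_basisElt (R := R) (n := n) 1
      rw [Nat.cast_one] at h2
      rw [Submodule.coe_zero]
      linear_combination sigma R n ^ 1 * h1 - (b : CyclicRing R n) * h2
    · intro ξ
      obtain ⟨φ, hφ, rfl⟩ := exists_eq_mk_twist ξ
      obtain ⟨b, hb, h⟩ := exists_sub_oddFun_mem hn r hφ
      -- The factor `σ` undoes the `σ⁻¹` built into the odd classes.
      refine ⟨⟨b * basisElt R n 1, mem_annIdeal.2 (by rw [← mul_assoc, hb, zero_mul])⟩, ?_⟩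
      refine ((mk_twist_eq_iff hφ (groupD_oddFun r (n_mul_annIdeal_mul ⟨b * basisElt R n 1,
        mem_annIdeal.2 (by rw [← mul_assoc, hb, zero_mul])⟩ _))).2 ?_).symm
      rwa [mul_assoc, basisElt_mul, add_neg_cancel, basisElt_zero, mul_one]
  · obtain rfl : n = 1 := le_antisymm hn (NeZero.one_le)
    have := subsingleton_HH_of_subsingleton (R := R) (n := 1) (2 * r)
    refine ⟨fun a b _ => Subtype.ext ?_, fun ξ => ⟨0, this.elim _ _⟩⟩
    have ha := mem_annIdeal.1 a.2
    have hb := mem_annIdeal.1 b.2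
    rw [Nat.cast_one, one_mul] at ha hb
    rw [ha, hb]

/-! ### Products in low degrees -/

variable (R n) in
/-- The even classes in the cohomology ring. -/
noncomputable def evenElt (r : ℕ) : CyclicRing R n →ₗ[R] HHRing R (CyclicRing R n) :=
  DirectSum.lof R ℕ (HH R (CyclicRing R n)) _ ∘ₗ evenClass R n r

variable (R n) in
/-- The odd classes in the cohomology ring. -/
noncomputable def oddElt (r : ℕ) : annIdeal R n →ₗ[R] HHRing R (CyclicRing R n) :=
  DirectSum.lof R ℕ (HH R (CyclicRing R n)) _ ∘ₗ oddClass R n r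

omit [NeZero n] in
theorem evenFun_one (a : CyclicRing R n) :
    evenFun n 1 a = fun g => -(carry n (g 0) (g 1) * a : CyclicRing R n) := by
  rw [evenFun_succ 0, evenFun_zero]
  rfl

theorem evenElt_zero_mul_evenElt_zero (a b : CyclicRing R n) :
    evenElt R n 0 a * evenElt R n 0 b = evenElt R n 0 (a * b) :=
  twistClass_mul_of_eq (k := 0) (l := 0) (groupD_evenFun 0 a) (groupD_evenFun 0 b)
    (groupD_evenFun 0 (a * b)) fun g => by
      simp only [evenFun_zero]

theorem evenElt_zero_mul_oddElt_zero (a : CyclicRing R n) (b : annIdeal R n) :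
    evenElt R n 0 a * oddElt R n 0 b = oddElt R n 0 (a • b) :=
  twistClass_mul_of_eq (k := 0) (l := 1) (groupD_evenFun 0 a)
    (groupD_oddFun 0 (n_mul_annIdeal_mul b _)) (groupD_oddFun 0 (n_mul_annIdeal_mul (a • b) _))
    fun g => by
      simp only [evenFun_zero, oddFun_zero, Submodule.coe_smul, smul_eq_mul]
      change a * -((g 0).val * _) = _
      ring

theorem oddElt_zero_mul_evenElt_zero (a : CyclicRing R n) (b : annIdeal R n) :
    oddElt R n 0 b * evenElt R n 0 a = oddElt R n 0 (a • b) :=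
  twistClass_mul_of_eq (k := 1) (l := 0) (groupD_oddFun 0 (n_mul_annIdeal_mul b _))
    (groupD_evenFun 0 a) (groupD_oddFun 0 (n_mul_annIdeal_mul (a • b) _))
    fun g => by
      simp only [evenFun_zero, oddFun_zero, Submodule.coe_smul, smul_eq_mul]
      change -((g 0).val * _) * a = _
      ring

theorem evenElt_mul_evenElt_one (r : ℕ) (a : CyclicRing R n) :
    evenElt R n r a * evenElt R n 1 1 = evenElt R n (r + 1) a :=
  twistClass_mul_of_eq (k := 2 * r) (l := 2) (groupD_evenFun r a) (groupD_evenFun 1 1)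
    (groupD_evenFun (r + 1) a) fun g => by
      rw [evenFun_one, evenFun_succ]
      change evenFun n r a _ * -(_ * 1) = -(_ * evenFun n r a _)
      rw [mul_one, mul_neg, mul_comm]
      rfl

theorem oddElt_mul_evenElt_one (r : ℕ) (b : annIdeal R n) :
    oddElt R n r b * evenElt R n 1 1 = oddElt R n (r + 1) b :=
  twistClass_mul_of_eq (k := 2 * r + 1) (l := 2) (groupD_oddFun r (n_mul_annIdeal_mul b _))
    (groupD_evenFun 1 1) (groupD_oddFun (r + 1) (n_mul_annIdeal_mul b _)) fun g => by
      rw [evenFun_one, oddFun_succ]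
      change oddFun n r _ _ * -(_ * 1) = -(_ * oddFun n r _ _)
      rw [mul_one, mul_neg, mul_comm]
      rfl

theorem evenElt_one_mul_evenElt_zero (a : CyclicRing R n) :
    evenElt R n 1 1 * evenElt R n 0 a = evenElt R n 1 a :=
  twistClass_mul_of_eq (k := 2) (l := 0) (groupD_evenFun 1 1) (groupD_evenFun 0 a)
    (groupD_evenFun 1 a) fun g => by
      rw [evenFun_one, evenFun_one, evenFun_zero]
      change -(_ * 1) * a = -(_ * a)
      rw [mul_one, neg_mul]
      rfl

/-- Here the carry stands on the left, while the odd cocycles have it on the right, so equality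
holds only up to the homotopy `groupD_two_carry_swap`. -/
theorem evenElt_one_mul_oddElt_zero (b : annIdeal R n) :
    evenElt R n 1 1 * oddElt R n 0 b = oddElt R n 1 b :=
  twistClass_mul (k := 2) (l := 1) (groupD_evenFun 1 1)
    (groupD_oddFun 0 (n_mul_annIdeal_mul b _)) (groupD_oddFun 1 (n_mul_annIdeal_mul b _)) (by
      have hw := groupD_two_carry_swap _ (n_mul_annIdeal_mul b (basisElt R n (-1)))
      rw [← sub_eq_iff_eq_add'] at hw
      refine ⟨_, hw.symm.trans ?_⟩
      rw [evenFun_one, oddFun_succ 0, oddFun_zero]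
      ext1 g
      change (carry n (g 0) (g 1) * ((g 2).val * _) - carry n (g 1) (g 2) * ((g 0).val * _) :
        CyclicRing R n) = -((carry n (g 0) (g 1) : CyclicRing R n) * 1) * -((g 2).val * _) -
          -(carry n (g 1) (g 2) * -((g 0).val * _))
      ring)

theorem oddElt_zero_mul_oddElt_zero (a b : annIdeal R n) :
    oddElt R n 0 a * oddElt R n 0 b = evenElt R n 1
      (-(((n * (n - 1) / 2 : ℕ) : CyclicRing R n) *
        ((a : CyclicRing R n) * (b : CyclicRing R n) * sigma R n ^ (n - 2)))) :=
  twistClass_mul (k := 1) (l := 1) (groupD_oddFun 0 (n_mul_annIdeal_mul a _))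
    (groupD_oddFun 0 (n_mul_annIdeal_mul b _)) (groupD_evenFun 1 _) (by
      -- For `n ≥ 2` this is `σ^(n-2) = σ⁻²`. For `n = 1` the subtraction truncates, but then `a =
      -- 0`.
      have hs : (a * b * sigma R n ^ (n - 2) : CyclicRing R n) =
          a * b * (basisElt R n (-1) * basisElt R n (-1)) := by
        rcases Nat.lt_or_ge 1 n with hn | hn
        · rw [sigma_pow, Nat.cast_sub hn, ZMod.natCast_self, basisElt_mul]
          congr 2
          push_cast; ring
        · obtain rfl : n = 1 := le_antisymm hn (NeZero.one_le)
          have ha := mem_annIdeal.1 a.2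
          rw [Nat.cast_one, one_mul] at ha
          rw [ha]; simp
      have hw := groupD_one_choose (n := n)
        (a * b * (basisElt R n (-1) * basisElt R n (-1)) : CyclicRing R n)
        (by rw [mul_assoc (a : CyclicRing R n)]; exact n_mul_annIdeal_mul a _)
      rw [← sub_eq_iff_eq_add'] at hw
      refine ⟨_, hw.symm.trans ?_⟩
      rw [evenFun_one, oddFun_zero, oddFun_zero, hs]
      ext1 g
      change ((g 0).val * ((g 1).val * _) - carry n (g 0) (g 1) * _ : CyclicRing R n) =
        -((g 0).val * _) * -((g 1).val * _) - -(carry n (g 0) (g 1) * _)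
      ring)

theorem evenElt_zero_one : evenElt R n 0 1 = 1 := by
  refine congrArg (DirectSum.of (HH R (CyclicRing R n)) 0) ?_
  change Submodule.Quotient.mk _ = Submodule.Quotient.mk _
  refine congrArg _ (Subtype.ext (cochain_ext_basisElt fun g => ?_))
  refine (twist_basisElt _ g).trans ?_
  rw [evenFun_zero, Cochain.of_apply]
  simp [AddMonoidAlgebra.one_def]

/-! ### Additive generators and linear maps out of the cohomology ring -/

theorem HHRing_induction {P : HHRing R (CyclicRing R n) → Prop}
    (even : ∀ r a, P (evenElt R n r a)) (odd : ∀ r b, P (oddElt R n r b))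
    (add : ∀ ξ η, P ξ → P η → P (ξ + η)) (ξ : HHRing R (CyclicRing R n)) : P ξ := by
  induction ξ using DirectSum.induction_on with
  | zero => rw [← map_zero (evenElt R n 0)]; exact even 0 0
  | of k x =>
    rcases Nat.even_or_odd' k with ⟨r, rfl | rfl⟩
    · obtain ⟨a, rfl⟩ := evenClass_surjective r x
      exact even r a
    · obtain ⟨b, rfl⟩ := (oddClass_bijective r).2 x
      exact odd r b
  | add ξ η h h' => exact add ξ η h h'

theorem exists_comp_eq_of_ker_le {M N Q : Type*} [AddCommGroup M] [AddCommGroup N]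
    [AddCommGroup Q] [Module R M] [Module R N] [Module R Q] (f : M →ₗ[R] N)
    (hf : Function.Surjective f) (g : M →ₗ[R] Q) (hg : LinearMap.ker f ≤ LinearMap.ker g) :
    ∃ h : N →ₗ[R] Q, ∀ x, h (f x) = g x := by
  refine ⟨(LinearMap.ker f).liftQ g hg ∘ₗ (f.quotKerEquivOfSurjective hf).symm.toLinearMap,
    fun x => ?_⟩
  have : (f.quotKerEquivOfSurjective hf).symm (f x) = Submodule.Quotient.mk x := by
    rw [LinearEquiv.symm_apply_eq]; rfl
  simp [this]

theorem exists_comp_eq_of_injective {M N Q : Type*} [AddCommGroup M] [AddCommGroup N]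
    [AddCommGroup Q] [Module R M] [Module R N] [Module R Q] (f : M →ₗ[R] N)
    (hf : Function.Surjective f) (g : M →ₗ[R] Q) (hg : Function.Injective f) :
    ∃ h : N →ₗ[R] Q, ∀ x, h (f x) = g x :=
  exists_comp_eq_of_ker_le f hf g ((LinearMap.ker_eq_bot.2 hg).trans_le bot_le)

theorem exists_comp_evenClass {Q : Type*} [AddCommGroup Q] [Module R Q] {r : ℕ}
    (f : CyclicRing R n →ₗ[R] Q) (hf : 1 ≤ r → ∀ a ∈ normIdeal R n, f a = 0) :
    ∃ h : HH R (CyclicRing R n) (2 * r) →ₗ[R] Q, ∀ a, h (evenClass R n r a) = f a := by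
  cases r with
  | zero =>
    exact exists_comp_eq_of_injective (evenClass R n 0) (evenClass_surjective 0) f
      evenClass_zero_bijective.1
  | succ r =>
    refine exists_comp_eq_of_ker_le (evenClass R n (r + 1)) (evenClass_surjective _) f ?_
    rw [ker_evenClass_succ]
    intro a ha
    exact hf (by omega) a ha

theorem exists_comp_oddClass {Q : Type*} [AddCommGroup Q] [Module R Q] {r : ℕ}
    (f : annIdeal R n →ₗ[R] Q) :
    ∃ h : HH R (CyclicRing R n) (2 * r + 1) →ₗ[R] Q, ∀ b, h (oddClass R n r b) = f b :=
  exists_comp_eq_of_injective (oddClass R n r) (oddClass_bijective r).2 f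
    (oddClass_bijective r).1

/-- Stated for an arbitrary degree `k`, with classes transported along `hk`, so that one choice over
all `k` gives the family that `DirectSum.toModule` needs without splitting the index by parity. -/
theorem HH_exists_linearMap {Q : Type*} [AddCommGroup Q] [Module R Q]
    (f : ℕ → CyclicRing R n →ₗ[R] Q) (g : ℕ → annIdeal R n →ₗ[R] Q)
    (hf : ∀ r, 1 ≤ r → ∀ a ∈ normIdeal R n, f r a = 0) (k : ℕ) :
    ∃ h : HH R (CyclicRing R n) k →ₗ[R] Q,
      (∀ r a (hk : 2 * r = k), h (hk ▸ evenClass R n r a) = f r a) ∧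
      (∀ r b (hk : 2 * r + 1 = k), h (hk ▸ oddClass R n r b) = g r b) := by
  rcases Nat.even_or_odd' k with ⟨r, rfl | rfl⟩
  · obtain ⟨h, hh⟩ := exists_comp_evenClass (f r) (hf r)
    refine ⟨h, fun s a hk => ?_, fun s b hk => by omega⟩
    obtain rfl : s = r := by omega
    exact hh a
  · obtain ⟨h, hh⟩ := exists_comp_oddClass (g r)
    refine ⟨h, fun s a hk => by omega, fun s b hk => ?_⟩
    obtain rfl : s = r := by omega
    exact hh b

theorem HHRing_exists_linearMap {Q : Type*} [AddCommGroup Q] [Module R Q]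
    (f : ℕ → CyclicRing R n →ₗ[R] Q) (g : ℕ → annIdeal R n →ₗ[R] Q)
    (hf : ∀ r, 1 ≤ r → ∀ a ∈ normIdeal R n, f r a = 0) :
    ∃ F : HHRing R (CyclicRing R n) →ₗ[R] Q,
      (∀ r a, F (evenElt R n r a) = f r a) ∧ ∀ r b, F (oddElt R n r b) = g r b := by
  choose h h1 h2 using HH_exists_linearMap f g hf
  refine ⟨DirectSum.toModule R ℕ Q h, fun r a => ?_, fun r b => ?_⟩
  · exact (DirectSum.toModule_lof R _ _).trans (h1 _ r a rfl)
  · exact (DirectSum.toModule_lof R _ _).trans (h2 _ r b rfl)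

end TwistClass

/-! ### Presentations and periodic product rules -/

section Abstract

open MvPolynomial

/-- Induction on `p` gives `F (aeval v p) = [p]`, so the induced map from the quotient has a left
inverse and is injective. `F` need only be linear and respect multiplication by the generators; its
values off the generated subalgebra do not matter. -/
theorem exists_quotient_algEquiv_of_comm {R B σ : Type*} [CommRing R] [CommRing B] [Algebra R B]
    (v : σ → B) (G : Set (MvPolynomial σ R))
    (hG : ∀ Φ : MvPolynomial σ R →ₐ[R] B, (∀ i, Φ (X i) = v i) → ∀ p ∈ G, Φ p = 0)
    (F : B →ₗ[R] MvPolynomial σ R ⧸ Ideal.span G) (h1 : F 1 = 1)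
    (hX : ∀ ξ i, F (ξ * v i) = F ξ * Ideal.Quotient.mk _ (X i))
    (S : Subalgebra R B) (hS : Algebra.adjoin R (Set.range v) = S) :
    ∃ e : (MvPolynomial σ R ⧸ Ideal.span G) ≃ₐ[R] S,
      ∀ i, (e (Ideal.Quotient.mk _ (X i)) : B) = v i := by
  subst hS
  have hle : Ideal.span G ≤ RingHom.ker (aeval v : MvPolynomial σ R →ₐ[R] B) :=
    Ideal.span_le.2 fun p hp => hG (aeval v) (fun i => aeval_X v i) p hp
  have hF (p : MvPolynomial σ R) : F (aeval v p) = Ideal.Quotient.mk _ p := by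
    induction p using MvPolynomial.induction_on with
    | C a =>
      rw [← algebraMap_eq, AlgHom.commutes, Algebra.algebraMap_eq_smul_one, map_smul, h1,
        Algebra.algebraMap_eq_smul_one]
      rfl
    | add p q hp hq => rw [map_add, map_add, hp, hq, map_add]
    | mul_X p i hp => rw [map_mul, aeval_X, hX, hp, map_mul]
  let Ψ : (MvPolynomial σ R ⧸ Ideal.span G) →ₐ[R] B :=
    Ideal.Quotient.liftₐ _ (aeval v) fun p hp => hle hp
  have hΨ (p : MvPolynomial σ R) : Ψ (Ideal.Quotient.mk _ p) = aeval v p := rfl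
  have hinj : Function.Injective Ψ := by
    refine Function.LeftInverse.injective (g := F) fun q => ?_
    obtain ⟨p, rfl⟩ := Ideal.Quotient.mk_surjective q
    rw [hΨ, hF]
  have hrange : Ψ.range = Algebra.adjoin R (Set.range v) := by
    rw [Algebra.adjoin_range_eq_range_aeval]
    ext b
    constructor
    · rintro ⟨q, rfl⟩
      obtain ⟨p, rfl⟩ := Ideal.Quotient.mk_surjective q
      exact ⟨p, rfl⟩
    · rintro ⟨p, rfl⟩
      exact ⟨Ideal.Quotient.mk _ p, rfl⟩
  refine ⟨(AlgEquiv.ofInjective Ψ hinj).trans (Subalgebra.equivOfEq _ _ hrange), fun i => ?_⟩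
  exact aeval_X v i

/-- The cohomology ring has only a `Ring` instance, with commutativity proved separately. The
relations are phrased through an arbitrary `Φ` because `aeval` into `B` is unavailable until the
commutative structure is installed. -/
theorem exists_quotient_algEquiv {R B σ : Type*} [CommRing R] [Ring B] [Algebra R B]
    (hcomm : ∀ a b : B, a * b = b * a) (v : σ → B) (G : Set (MvPolynomial σ R))
    (hG : ∀ Φ : MvPolynomial σ R →ₐ[R] B, (∀ i, Φ (X i) = v i) → ∀ p ∈ G, Φ p = 0)
    (F : B →ₗ[R] MvPolynomial σ R ⧸ Ideal.span G) (h1 : F 1 = 1)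
    (hX : ∀ ξ i, F (ξ * v i) = F ξ * Ideal.Quotient.mk _ (X i))
    (S : Subalgebra R B) (hS : Algebra.adjoin R (Set.range v) = S) :
    ∃ e : (MvPolynomial σ R ⧸ Ideal.span G) ≃ₐ[R] S,
      ∀ i, (e (Ideal.Quotient.mk _ (X i)) : B) = v i :=
  letI : CommRing B := { ‹Ring B› with mul_comm := hcomm }
  exists_quotient_algEquiv_of_comm v G hG F h1 hX S hS

/-- The product rules for two families of additive generators `E r a` and `O r b` of an algebra,
where `E 1 1` plays the role of a periodicity class. -/
structure PeriodicProducts {R A B : Type*} [CommRing R] [CommRing A] [Algebra R A] [Ring B]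
    [Algebra R B] {N : Ideal A} (E : ℕ → A →ₗ[R] B) (O : ℕ → N →ₗ[R] B) (c : A) : Prop where
  one : E 0 1 = 1
  even_even : ∀ a b, E 0 a * E 0 b = E 0 (a * b)
  even_odd : ∀ a b, E 0 a * O 0 b = O 0 (a • b)
  odd_even : ∀ a b, O 0 b * E 0 a = O 0 (a • b)
  even_shift : ∀ r a, E r a * E 1 1 = E (r + 1) a
  odd_shift : ∀ r b, O r b * E 1 1 = O (r + 1) b
  shift_even : ∀ a, E 1 1 * E 0 a = E 1 a
  shift_odd : ∀ b, E 1 1 * O 0 b = O 1 b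
  odd_odd : ∀ a b : N, O 0 a * O 0 b = E 1 (c * (a * b))
  induction : ∀ {P : B → Prop} (_even : ∀ r a, P (E r a)) (_odd : ∀ r b, P (O r b))
    (_add : ∀ ξ η, P ξ → P η → P (ξ + η)) (ξ : B), P ξ

namespace PeriodicProducts

variable {R A B : Type*} [CommRing R] [CommRing A] [Algebra R A] [Ring B]
  [Algebra R B] {N : Ideal A} {E : ℕ → A →ₗ[R] B} {O : ℕ → N →ₗ[R] B} {c : A}
  (H : PeriodicProducts E O c)

include H

theorem even_eq (r : ℕ) (a : A) : E r a = E 0 a * E 1 1 ^ r := by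
  induction r with
  | zero => rw [pow_zero, mul_one]
  | succ r ih => rw [pow_succ, ← mul_assoc, ← ih, H.even_shift]

theorem odd_eq (r : ℕ) (b : N) : O r b = O 0 b * E 1 1 ^ r := by
  induction r with
  | zero => rw [pow_zero, mul_one]
  | succ r ih => rw [pow_succ, ← mul_assoc, ← ih, H.odd_shift]

theorem commute_even (r : ℕ) (a : A) : Commute (E 1 1 ^ r) (E 0 a) :=
  Commute.pow_left ((H.shift_even a).trans (H.even_shift 0 a).symm) r

theorem commute_odd (r : ℕ) (b : N) : Commute (E 1 1 ^ r) (O 0 b) :=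
  Commute.pow_left ((H.shift_odd b).trans (H.odd_shift 0 b).symm) r

theorem even_mul_even (r s : ℕ) (a b : A) : E r a * E s b = E (r + s) (a * b) := by
  rw [H.even_eq r, H.even_eq s, H.even_eq (r + s), mul_assoc, ← mul_assoc (_ ^ r),
    (H.commute_even r b).eq, mul_assoc, ← pow_add, ← mul_assoc,
    H.even_even]

theorem even_mul_odd (r s : ℕ) (a : A) (b : N) : E r a * O s b = O (r + s) (a • b) := by
  rw [H.even_eq r, H.odd_eq s, H.odd_eq (r + s), mul_assoc, ← mul_assoc (_ ^ r),
    (H.commute_odd r b).eq, mul_assoc, ← pow_add, ← mul_assoc, H.even_odd]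

theorem odd_mul_even (r s : ℕ) (a : A) (b : N) : O s b * E r a = O (s + r) (a • b) := by
  rw [H.even_eq r, H.odd_eq s, H.odd_eq (s + r), mul_assoc, ← mul_assoc (_ ^ s),
    (H.commute_even s a).eq, mul_assoc, ← pow_add, ← mul_assoc, H.odd_even]

theorem odd_mul_odd (r s : ℕ) (a b : N) : O r a * O s b = E (r + s + 1) (c * (a * b)) := by
  rw [H.odd_eq r, H.odd_eq s, H.even_eq (r + s + 1), mul_assoc, ← mul_assoc (_ ^ r),
    (H.commute_odd r b).eq, mul_assoc, ← pow_add, ← mul_assoc, H.odd_odd, H.even_eq 1, pow_one,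
    mul_assoc, ← pow_succ']

/-- Strict rather than graded commutativity: `odd_mul_odd` is symmetric in its two factors, with no
sign. -/
theorem mul_comm (ξ η : B) : ξ * η = η * ξ := by
  induction ξ using H.induction with
  | _add ξ ξ' h h' => rw [add_mul, mul_add, h, h']
  | _even r a =>
    induction η using H.induction with
    | _add η η' h h' => rw [add_mul, mul_add, h, h']
    | _even s b => rw [H.even_mul_even, H.even_mul_even, _root_.mul_comm, add_comm]
    | _odd s b => rw [H.even_mul_odd, H.odd_mul_even, add_comm]
  | _odd r a =>
    induction η using H.induction with
    | _add η η' h h' => rw [add_mul, mul_add, h, h']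
    | _even s b => rw [H.even_mul_odd, H.odd_mul_even, add_comm]
    | _odd s b =>
      rw [H.odd_mul_odd, H.odd_mul_odd, _root_.mul_comm (a : A), add_comm r]

theorem even_zero_pow (a : A) (k : ℕ) : E 0 a ^ k = E 0 (a ^ k) := by
  induction k with
  | zero => rw [pow_zero, pow_zero, H.one]
  | succ k ih => rw [pow_succ, ih, H.even_even, pow_succ]

theorem even_mem (S : Subalgebra R B) {G : Set A} (hG : Submodule.span R G = ⊤)
    (hS : ∀ g ∈ G, E 0 g ∈ S) (hz : E 1 1 ∈ S) (r : ℕ) (a : A) : E r a ∈ S := by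
  rw [H.even_eq]
  refine mul_mem ?_ (pow_mem hz r)
  have : Submodule.span R G ≤ (Subalgebra.toSubmodule S).comap (E 0) := Submodule.span_le.2 hS
  exact this (hG ▸ Submodule.mem_top)

end PeriodicProducts

end Abstract

/-! ### The ring presentations -/

section Main

open MvPolynomial

variable {R : Type*} [CommRing R] {n : ℕ}

theorem span_range_basisElt :
    Submodule.span R (Set.range (basisElt R n)) = ⊤ := by
  rw [show basisElt R n = groupBasis R n from funext fun t => (groupBasis_apply t).symm]
  exact (groupBasis R n).span_eq

variable [NeZero n]

theorem sigma_pow_val (t : ZMod n) : sigma R n ^ t.val = basisElt R n t := by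
  rw [sigma_pow, ZMod.natCast_zmod_val]

omit [NeZero n] in
theorem sigma_pow_self : sigma R n ^ n = 1 := by
  rw [sigma_pow, ZMod.natCast_self, basisElt_zero]

theorem exists_algHom_sigma {Q : Type*} [CommRing Q] [Algebra R Q] {x : Q} (hx : x ^ n = 1) :
    ∃ ψ : CyclicRing R n →ₐ[R] Q, ψ (sigma R n) = x := by
  let f : Multiplicative (ZMod n) →* Q :=
    { toFun := fun t => x ^ t.toAdd.val
      map_one' := by simp
      map_mul' := fun s t => by
        rw [toAdd_mul, ZMod.val_add, ← pow_add, ← pow_eq_pow_mod _ hx] }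
  refine ⟨AddMonoidAlgebra.lift R Q (ZMod n) f, ?_⟩
  rw [sigma, basisElt, AddMonoidAlgebra.lift_single, one_smul]
  change x ^ (1 : ZMod n).val = x
  rw [ZMod.val_one_eq_one_mod, ← pow_eq_pow_mod _ hx, pow_one]

variable (R n) in
theorem periodicProducts : PeriodicProducts (R := R) (A := CyclicRing R n)
    (B := HHRing R (CyclicRing R n)) (N := annIdeal R n) (evenElt R n) (oddElt R n)
    (-(((n * (n - 1) / 2 : ℕ) : CyclicRing R n) * sigma R n ^ (n - 2))) where
  one := evenElt_zero_one
  even_even := evenElt_zero_mul_evenElt_zero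
  even_odd := evenElt_zero_mul_oddElt_zero
  odd_even := oddElt_zero_mul_evenElt_zero
  even_shift := evenElt_mul_evenElt_one
  odd_shift := oddElt_mul_evenElt_one
  shift_even := evenElt_one_mul_evenElt_zero
  shift_odd := evenElt_one_mul_oddElt_zero
  odd_odd a b := (oddElt_zero_mul_oddElt_zero a b).trans (congrArg (evenElt R n 1) (by ring))
  induction even odd add := HHRing_induction even odd add

theorem evenElt_mem_evenPart (r : ℕ) (a : CyclicRing R n) :
    evenElt R n r a ∈ evenPart R (CyclicRing R n) := by
  intro k hk
  refine DirectSum.of_eq_of_ne _ _ _ fun h => ?_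
  rw [h] at hk
  exact (Nat.not_odd_iff_even.2 (even_two_mul r)) hk

theorem evenPart_le (S : Subalgebra R (HHRing R (CyclicRing R n)))
    (hS : ∀ r a, evenElt R n r a ∈ S) {ξ : HHRing R (CyclicRing R n)}
    (hξ : ξ ∈ evenPart R (CyclicRing R n)) : ξ ∈ S := by
  classical
  rw [← DirectSum.sum_support_of ξ]
  refine sum_mem fun k _ => ?_
  rcases Nat.even_or_odd' k with ⟨r, rfl | rfl⟩
  · obtain ⟨a, ha⟩ := evenClass_surjective r (ξ (2 * r))
    rw [← ha]
    exact hS r a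
  · rw [hξ _ (odd_two_mul_add_one r), map_zero]
    exact zero_mem _

theorem adjoin_eq_evenPart :
    Algebra.adjoin R (Set.range ![evenElt R n 0 (sigma R n), evenElt R n 1 1]) =
      evenPart R (CyclicRing R n) := by
  have H := periodicProducts R n
  refine le_antisymm (Algebra.adjoin_le ?_) fun ξ hξ => evenPart_le
    (Algebra.adjoin R _) (fun r a => ?_) hξ
  · rintro _ ⟨i, rfl⟩
    fin_cases i
    · exact evenElt_mem_evenPart 0 _
    · exact evenElt_mem_evenPart 1 _
  · refine H.even_mem _ span_range_basisElt ?_ (Algebra.subset_adjoin (Set.mem_range_self (1 : Fin 2))) r a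
    rintro _ ⟨t, rfl⟩
    rw [← sigma_pow_val, ← H.even_zero_pow]
    exact pow_mem (Algebra.subset_adjoin (Set.mem_range_self (0 : Fin 2))) _

variable (R n) in
theorem exists_evenPart_algEquiv :
    ∃ e : (MvPolynomial (Fin 2) R ⧸
        (Ideal.span {X 0 ^ n - 1, (n : MvPolynomial (Fin 2) R) * X 1} :
          Ideal (MvPolynomial (Fin 2) R))) ≃ₐ[R] evenPart R (CyclicRing R n),
      (e (Ideal.Quotient.mk _ (X 0)) : HHRing R (CyclicRing R n)) = evenElt R n 0 (sigma R n) ∧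
      (e (Ideal.Quotient.mk _ (X 1)) : HHRing R (CyclicRing R n)) = evenElt R n 1 1 := by
  have H := periodicProducts R n
  let I : Ideal (MvPolynomial (Fin 2) R) :=
    Ideal.span {X 0 ^ n - 1, (n : MvPolynomial (Fin 2) R) * X 1}
  have hx : (Ideal.Quotient.mk I (X 0)) ^ n = 1 := by
    rw [← map_pow, ← map_one (Ideal.Quotient.mk I), Ideal.Quotient.eq]
    exact Ideal.subset_span (Or.inl rfl)
  have hz : n * Ideal.Quotient.mk I (X 1) = 0 := by
    rw [← map_natCast (Ideal.Quotient.mk I), ← map_mul, Ideal.Quotient.eq_zero_iff_mem]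
    exact Ideal.subset_span (Or.inr rfl)
  obtain ⟨ψ, hψ⟩ := exists_algHom_sigma (R := R) hx
  -- The inverse sends the even class of `a` in degree `2r` to `ψ(a) z^r` and kills odd classes. It
  -- is well defined for `r ≥ 1` because `n z = 0`.
  obtain ⟨F, hF, hF'⟩ := HHRing_exists_linearMap (R := R) (n := n)
    (fun r => LinearMap.mulRight R (Ideal.Quotient.mk I (X 1) ^ r) ∘ₗ ψ.toLinearMap) (fun _ => 0)
    (fun r hr a ha => by
      obtain ⟨s, rfl⟩ := Nat.exists_eq_add_of_le' hr
      obtain ⟨x, rfl⟩ := mem_normIdeal.1 ha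
      simp only [LinearMap.comp_apply, AlgHom.toLinearMap_apply, LinearMap.mulRight_apply, map_mul,
        map_natCast]
      linear_combination ψ x * Ideal.Quotient.mk I (X 1) ^ s * hz)
  simp only [LinearMap.comp_apply, AlgHom.toLinearMap_apply, LinearMap.mulRight_apply,
    LinearMap.zero_apply] at hF hF'
  have h1 : F 1 = 1 := by
    rw [← evenElt_zero_one, hF]; simp
  have hX (ξ : HHRing R (CyclicRing R n)) (i : Fin 2) :
      F (ξ * ![evenElt R n 0 (sigma R n), evenElt R n 1 1] i) =
        F ξ * Ideal.Quotient.mk I (X i) := by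
    induction ξ using HHRing_induction with
    | add ξ η h h' =>
      refine (congrArg F (@add_mul _ _ _ (Distrib.rightDistribClass _) ξ η _)).trans ?_
      rw [map_add, map_add, h, h', add_mul]
    | even r a =>
      match i with
      | 0 =>
        refine (congrArg F (H.even_mul_even r 0 a (sigma R n))).trans ?_
        rw [hF, hF, map_mul, hψ, add_zero]
        ring
      | 1 =>
        refine (congrArg F (H.even_shift r a)).trans ?_
        rw [hF, hF]
        ring
    | odd r b =>
      match i with
      | 0 =>
        refine (congrArg F (H.odd_mul_even 0 r (sigma R n) b)).trans ?_
        rw [hF', hF', zero_mul]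
      | 1 =>
        refine (congrArg F (H.odd_shift r b)).trans ?_
        rw [hF', hF', zero_mul]
  obtain ⟨e, he⟩ := exists_quotient_algEquiv H.mul_comm
    ![evenElt R n 0 (sigma R n), evenElt R n 1 1] _ (fun Φ hΦ p hp => by
      rcases hp with rfl | rfl
      · rw [map_sub, map_pow, map_one, hΦ 0]
        change evenElt R n 0 (sigma R n) ^ n - 1 = 0
        rw [H.even_zero_pow, sigma_pow_self, H.one, sub_self]
      · rw [map_mul, map_natCast, hΦ 1]
        have : evenClass R n 1 (n • 1) = 0 := by
          rw [← LinearMap.mem_ker, ker_evenClass_succ 0]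
          exact mem_normIdeal.2 ⟨1, by rw [nsmul_eq_mul]⟩
        refine (nsmul_eq_mul n (evenElt R n 1 1)).symm.trans
          ((map_nsmul (evenElt R n 1) n 1).symm.trans ?_)
        rw [evenElt, LinearMap.comp_apply, this, map_zero])
    F h1 hX _ adjoin_eq_evenPart
  exact ⟨e, he 0, he 1⟩

theorem adjoin_eq_top {t : annIdeal R n} (ht : (t : CyclicRing R n) = 1) :
    Algebra.adjoin R
      (Set.range ![evenElt R n 0 (sigma R n), oddElt R n 0 t, evenElt R n 1 1]) = ⊤ := by
  have H := periodicProducts R n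
  have hE (r : ℕ) (a : CyclicRing R n) : evenElt R n r a ∈ Algebra.adjoin R
      (Set.range ![evenElt R n 0 (sigma R n), oddElt R n 0 t, evenElt R n 1 1]) := by
    refine H.even_mem _ span_range_basisElt ?_ (Algebra.subset_adjoin (Set.mem_range_self 2)) r a
    rintro _ ⟨t, rfl⟩
    rw [← sigma_pow_val, ← H.even_zero_pow]
    exact pow_mem (Algebra.subset_adjoin (Set.mem_range_self 0)) _
  refine eq_top_iff.2 fun ξ _ => ?_
  induction ξ using HHRing_induction with
  | even r a => exact hE r a
  | add ξ η h h' => exact add_mem (h trivial) (h' trivial)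
  | odd r b =>
    -- With `1` in the annihilator, every odd class is an even class times `y`.
    have hb : (b : CyclicRing R n) • t = b := Subtype.ext (by simp [ht])
    have h := H.even_mul_odd r 0 b t
    rw [hb, add_zero] at h
    rw [← h]
    exact mul_mem (hE r b) (Algebra.subset_adjoin (Set.mem_range_self 1))

variable (R n) in
-- Treats both characteristic cases at once through `ε = -n(n-1)/2` in `R`. Because `n = 0` in `R`,
-- no quotient or torsion condition survives, and `n z` imposes nothing.
theorem exists_HHRing_algEquiv (hn : (n : R) = 0) {t : annIdeal R n}
    (ht : (t : CyclicRing R n) = 1) {ε : R} (hε : -((n * (n - 1) / 2 : ℕ) : R) = ε)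
    {q : MvPolynomial (Fin 3) R} (hq : q = X 1 ^ 2 - C ε * (X 0 ^ (n - 2) * X 2)) :
    ∃ e : (MvPolynomial (Fin 3) R ⧸
        (Ideal.span {X 0 ^ n - 1, q} : Ideal (MvPolynomial (Fin 3) R))) ≃ₐ[R]
          HHRing R (CyclicRing R n),
      e (Ideal.Quotient.mk _ (X 0)) = evenElt R n 0 (sigma R n) ∧
      e (Ideal.Quotient.mk _ (X 1)) = oddElt R n 0 t ∧
      e (Ideal.Quotient.mk _ (X 2)) = evenElt R n 1 1 := by
  have H := periodicProducts R n
  have hc : (-(((n * (n - 1) / 2 : ℕ) : CyclicRing R n) * sigma R n ^ (n - 2))) =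
      algebraMap R (CyclicRing R n) ε * sigma R n ^ (n - 2) := by
    rw [← hε, map_neg, map_natCast, neg_mul]
  rw [hc] at H
  have hnA : (n : CyclicRing R n) = 0 := by
    rw [← map_natCast (algebraMap R (CyclicRing R n)), hn, map_zero]
  let I : Ideal (MvPolynomial (Fin 3) R) := Ideal.span {X 0 ^ n - 1, q}
  let m : MvPolynomial (Fin 3) R →ₐ[R] MvPolynomial (Fin 3) R ⧸ I := Ideal.Quotient.mkₐ R I
  have hx : (m (X 0)) ^ n = 1 := by
    rw [← map_pow, ← sub_eq_zero, ← map_one m, ← map_sub]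
    exact Ideal.Quotient.eq_zero_iff_mem.2 (Ideal.subset_span (Or.inl rfl))
  have hy : m (X 1) ^ 2 = algebraMap R _ ε * (m (X 0) ^ (n - 2) * m (X 2)) := by
    have : m q = 0 := Ideal.Quotient.eq_zero_iff_mem.2 (Ideal.subset_span (Or.inr rfl))
    rw [hq, map_sub, sub_eq_zero, map_pow, map_mul, map_mul, map_pow, ← algebraMap_eq,
      AlgHom.commutes] at this
    exact this
  obtain ⟨ψ, hψ⟩ := exists_algHom_sigma (R := R) hx
  -- Even classes go to `ψ(a) z^r` and odd ones to `ψ(b) y z^r`. Compatibility with multiplication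
  -- by `y` on odd classes is exactly the relation `hy`.
  obtain ⟨F, hF, hF'⟩ := HHRing_exists_linearMap (R := R) (n := n)
    (fun r => LinearMap.mulRight R (m (X 2) ^ r) ∘ₗ ψ.toLinearMap)
    (fun r => LinearMap.mulRight R (m (X 1) * m (X 2) ^ r) ∘ₗ ψ.toLinearMap ∘ₗ
      (annIdeal R n).subtype.restrictScalars R)
    (fun r hr a ha => by
      obtain ⟨x, rfl⟩ := mem_normIdeal.1 ha
      rw [hnA, zero_mul, map_zero])
  simp only [LinearMap.comp_apply, AlgHom.toLinearMap_apply, LinearMap.mulRight_apply,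
    LinearMap.coe_restrictScalars, Submodule.subtype_apply] at hF hF'
  have h1 : F 1 = 1 := by
    rw [← evenElt_zero_one, hF]; simp
  have hX (ξ : HHRing R (CyclicRing R n)) (i : Fin 3) :
      F (ξ * ![evenElt R n 0 (sigma R n), oddElt R n 0 t, evenElt R n 1 1] i) =
        F ξ * m (X i) := by
    induction ξ using HHRing_induction with
    | add ξ η h h' =>
      refine (congrArg F (@add_mul _ _ _ (Distrib.rightDistribClass _) ξ η _)).trans ?_
      rw [map_add, map_add, h, h', add_mul]
    | even r a =>
      match i with
      | 0 =>
        refine (congrArg F (H.even_mul_even r 0 a (sigma R n))).trans ?_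
        rw [hF, hF, map_mul, hψ, add_zero]
        ring
      | 1 =>
        refine (congrArg F (H.even_mul_odd r 0 a t)).trans ?_
        rw [hF, hF', Submodule.coe_smul, ht, smul_eq_mul, mul_one, add_zero]
        ring
      | 2 =>
        refine (congrArg F (H.even_shift r a)).trans ?_
        rw [hF, hF]
        ring
    | odd r b =>
      match i with
      | 0 =>
        refine (congrArg F (H.odd_mul_even 0 r (sigma R n) b)).trans ?_
        rw [hF', hF', Submodule.coe_smul, smul_eq_mul, map_mul, hψ, add_zero]
        ring
      | 1 =>
        refine (congrArg F (H.odd_mul_odd r 0 b t)).trans ?_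
        rw [hF, hF', ht, mul_one, map_mul, map_mul, map_pow, hψ, AlgHom.commutes]
        linear_combination (-ψ b * m (X 2) ^ r) * hy
      | 2 =>
        refine (congrArg F (H.odd_shift r b)).trans ?_
        rw [hF', hF']
        ring
  obtain ⟨e, he⟩ := exists_quotient_algEquiv H.mul_comm
    ![evenElt R n 0 (sigma R n), oddElt R n 0 t, evenElt R n 1 1] _ (fun Φ hΦ p hp => by
      rcases hp with rfl | rfl
      · rw [map_sub, map_pow, map_one, hΦ 0]
        change evenElt R n 0 (sigma R n) ^ n - 1 = 0
        rw [H.even_zero_pow, sigma_pow_self, H.one, sub_self]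
      · rw [hq, map_sub, map_pow, map_mul, map_mul, map_pow, hΦ 0, hΦ 1, hΦ 2, ← algebraMap_eq,
          AlgHom.commutes, pow_two, sub_eq_zero]
        refine (H.odd_odd t t).trans ?_
        rw [ht, mul_one, mul_one, H.even_eq 1, pow_one, ← H.even_even, ← H.even_zero_pow,
          Algebra.algebraMap_eq_smul_one, map_smul, H.one, Algebra.algebraMap_eq_smul_one, mul_assoc]
        rfl)
    F h1 hX _ (adjoin_eq_top ht)
  exact ⟨e.trans Subalgebra.topEquiv, he 0, he 1, he 2⟩

theorem dvd_mul_pred_div_two {n p m : ℕ} (hn : n = m * p) (h : Odd p ∨ Even m) :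
    p ∣ n * (n - 1) / 2 := by
  rcases h with h | ⟨k, hk⟩
  · have h2 : 2 * (n * (n - 1) / 2) = n * (n - 1) :=
      Nat.mul_div_cancel' (Nat.even_mul_pred_self n).two_dvd
    refine Nat.Coprime.dvd_of_dvd_mul_left (Nat.coprime_two_right.2 h) ?_
    rw [h2, hn]
    exact Dvd.intro_left m rfl |>.mul_right _
  · refine ⟨k * (n - 1), ?_⟩
    refine Nat.div_eq_of_eq_mul_left (by norm_num) ?_
    conv_lhs => rw [hn, hk]
    rw [hn, hk]
    ring

theorem odd_mul_pred_div_two {n m : ℕ} (hn : n = m * 2) (hm : Odd m) :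
    Odd (n * (n - 1) / 2) := by
  have : n * (n - 1) / 2 = m * (n - 1) :=
    Nat.div_eq_of_eq_mul_left (by norm_num) (by conv_lhs => rw [hn]
                                                rw [hn]; ring)
  rw [this]
  refine hm.mul ?_
  obtain ⟨k, rfl⟩ := hm
  exact ⟨2 * k, by omega⟩

end Main

end Hochschild

open Hochschild MvPolynomial in
theorem mainTheorem5 {R : Type*} [CommRing R] (n : ℕ) [NeZero n] :
    -- `E r` and `O r` send `a` to the class of the explicit cocycle attached to `a`
    ∃ (E : ∀ r : ℕ, CyclicRing R n →ₗ[R] HH R (CyclicRing R n) (2 * r))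
      (O : ∀ r : ℕ, annIdeal R n →ₗ[R] HH R (CyclicRing R n) (2 * r + 1)),
      (∀ r a, Represents (evenCochain r a) (E r a)) ∧
      (∀ r (a : annIdeal R n), Represents (oddCochain r (a : CyclicRing R n)) (O r a)) ∧
      -- they identify `HH^0 = A`, `HH^{2r} = A/(n σ^{n-1})` for `r ≥ 1`, and
      -- `HH^{2r+1} = Ann(n σ^{n-1})`
      Function.Bijective (E 0) ∧
      (∀ r, 1 ≤ r → Function.Surjective (E r) ∧
        LinearMap.ker (E r) = (normIdeal R n).restrictScalars R) ∧
      (∀ r, Function.Bijective (O r)) ∧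
      -- cup products in which a factor has even degree are induced by the product of `A`
      (∀ r s a b, DirectSum.of (HH R (CyclicRing R n)) _ (E r a) * DirectSum.of _ _ (E s b) =
        DirectSum.of _ _ (E (r + s) (a * b))) ∧
      (∀ r s a b, DirectSum.of (HH R (CyclicRing R n)) _ (E r a) * DirectSum.of _ _ (O s b) =
        DirectSum.of _ _ (O (r + s) (a • b))) ∧
      (∀ r s a b, DirectSum.of (HH R (CyclicRing R n)) _ (O s b) * DirectSum.of _ _ (E r a) =
        DirectSum.of _ _ (O (s + r) (a • b))) ∧
      -- cup products of two classes of odd degree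
      (∀ r s a b, DirectSum.of (HH R (CyclicRing R n)) _ (O r a) * DirectSum.of _ _ (O s b) =
        DirectSum.of _ _ (E (r + s + 1)
          (-(((n * (n - 1) / 2 : ℕ) : CyclicRing R n) *
            ((a : CyclicRing R n) * (b : CyclicRing R n) * sigma R n ^ (n - 2)))))) ∧
      -- the even cohomology ring `R[x, z] / (x^n - 1, n z)`
      (∃ e : (MvPolynomial (Fin 2) R ⧸
            (Ideal.span {X 0 ^ n - 1, (n : MvPolynomial (Fin 2) R) * X 1} :
              Ideal (MvPolynomial (Fin 2) R))) ≃ₐ[R] evenPart R (CyclicRing R n),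
        (e (Ideal.Quotient.mk _ (X 0)) : HHRing R (CyclicRing R n)) =
          DirectSum.of _ _ (E 0 (sigma R n)) ∧
        (e (Ideal.Quotient.mk _ (X 1)) : HHRing R (CyclicRing R n)) =
          DirectSum.of _ _ (E 1 1)) ∧
      -- the full cohomology ring in characteristic `p > 0`, with `n = m p`
      (∀ p m : ℕ, 0 < p → CharP R p → n = m * p →
        ((Odd p ∨ Even m) →
          ∃ (h1 : (1 : CyclicRing R n) ∈ annIdeal R n)
            (e : (MvPolynomial (Fin 3) R ⧸
              (Ideal.span {X 0 ^ n - 1, X 1 ^ 2} : Ideal (MvPolynomial (Fin 3) R))) ≃ₐ[R]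
                HHRing R (CyclicRing R n)),
            e (Ideal.Quotient.mk _ (X 0)) = DirectSum.of _ _ (E 0 (sigma R n)) ∧
            e (Ideal.Quotient.mk _ (X 1)) = DirectSum.of _ _ (O 0 ⟨1, h1⟩) ∧
            e (Ideal.Quotient.mk _ (X 2)) = DirectSum.of _ _ (E 1 1)) ∧
        (p = 2 → Odd m →
          ∃ (h1 : (1 : CyclicRing R n) ∈ annIdeal R n)
            (e : (MvPolynomial (Fin 3) R ⧸
              (Ideal.span {X 0 ^ n - 1, X 1 ^ 2 - X 0 ^ (n - 2) * X 2} :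
                Ideal (MvPolynomial (Fin 3) R))) ≃ₐ[R] HHRing R (CyclicRing R n)),
            e (Ideal.Quotient.mk _ (X 0)) = DirectSum.of _ _ (E 0 (sigma R n)) ∧
            e (Ideal.Quotient.mk _ (X 1)) = DirectSum.of _ _ (O 0 ⟨1, h1⟩) ∧
            e (Ideal.Quotient.mk _ (X 2)) = DirectSum.of _ _ (E 1 1))) := by
  have H := periodicProducts R n
  refine ⟨evenClass R n, oddClass R n, represents_evenClass, represents_oddClass,
    evenClass_zero_bijective, fun r hr => ⟨evenClass_surjective r, ?_⟩, oddClass_bijective,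
    H.even_mul_even, H.even_mul_odd, fun r s a b => H.odd_mul_even r s a b,
    fun r s a b => (H.odd_mul_odd r s a b).trans (congrArg (evenElt R n (r + s + 1)) (by ring)),
    exists_evenPart_algEquiv R n, fun p m _ hp hn => ?_⟩
  · obtain ⟨s, rfl⟩ := Nat.exists_eq_add_of_le' hr
    exact ker_evenClass_succ s
  · have hn0 : (n : R) = 0 := by rw [hn, Nat.cast_mul, CharP.cast_eq_zero R p, mul_zero]
    have h1 : (1 : CyclicRing R n) ∈ annIdeal R n := by
      rw [mem_annIdeal, ← map_natCast (algebraMap R (CyclicRing R n)), hn0, map_zero, zero_mul]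
    refine ⟨fun h => ⟨h1, ?_⟩, fun h2 hm => ⟨h1, ?_⟩⟩
    · refine exists_HHRing_algEquiv R n hn0 (t := ⟨1, h1⟩) rfl (ε := 0) ?_ (by simp)
      rw [(CharP.cast_eq_zero_iff R p _).2 (dvd_mul_pred_div_two hn h), neg_zero]
    · subst h2
      refine exists_HHRing_algEquiv R n hn0 (t := ⟨1, h1⟩) rfl (ε := 1) ?_ (by simp)
      -- An odd integer is `1` in characteristic 2, so `ε = -1 = 1`.
      obtain ⟨k, hk⟩ := odd_mul_pred_div_two hn hm
      have h20 : (2 : R) = 0 := by exact_mod_cast CharP.cast_eq_zero R 2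
      rw [hk]
      push_cast
      linear_combination (-(k : R) - 1) * h20
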